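/- Let $n\ge 1$, let $B(\Gamma_0(n))$ be the normalizer of $\Gamma_0(n)$ in $\mathrm{GL}_2(\mathbb Q)^+$, and let $\mathcal L_n$ be the set of pairs of lattices $(L,L')$ in $\mathbb C$ with $L\subseteq L'$ and $L'/L$ cyclic of order $n$. Let $\mathcal L_{\mathbb Q}$ be the set of homomorphisms $\psi:\mathbb Q^2\to\mathbb C$ with $\operatorname{Im}(\psi(1,0)/\psi(0,1))>0$. Put $L_\psi=\psi(\mathbb Z^2)$ and $\gamma_n=\mathrm{diag}(n,1)$, and let $\mathrm{GL}_2(\mathbb Q)^+$ act by $(\gamma\psi)(v)=(\det\gamma)^{-1}\psi(v\gamma)$. The map $\pi_n(\psi)=(L_\psi,L_{\gamma_n\psi})$ from $\mathcal L_{\mathbb Q}$ to $\mathcal L_n$ is surjective with the $\Gamma_0(n)$-orbits as fibres, so $B(\Gamma_0(n))$ acts on $\mathcal L_n$ by $\gamma\,\pi_n(\psi)=\pi_n(\gamma\psi)$. Let $\mathcal C_n^{\mathrm{an}}$ be the set of isomorphism classes of triples $(E,C,\omega)$, where $E$ is a complex analytic elliptic curve (a compact connected one-dimensional complex Lie group),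 $C\subset E$ is a cyclic subgroup of order $n$ and $\omega$ is a nowhere vanishing holomorphic differential on $E$. Put $F_n(L,L')=[(\mathbb C/L,\;L'/L,\;2\pi i\,dz)]$. For $\gamma\in B(\Gamma_0(n))$ the value $\gamma(E,C,\omega)$ is constructed as follows. Write $\gamma=a\left(\begin{smallmatrix}p&q\\r&s\end{smallmatrix}\right)$ with $a\in\mathbb Q^\times$, $p,q,r,s\in\mathbb Z$ and $\delta=ps-qr>0$. Choose an isomorphism $\phi:(\mathbb Z/n\delta\mathbb Z)^2\to E[n\delta]$ such that $\phi(0,\delta)$ generates $C$. Put $C_\gamma=n\langle\phi(p,q),\phi(r,s)\rangle$, $E'=E/C_\gamma$, $C'=(\langle\phi(r,s)\rangle+C_\gamma)/C_\gamma$, and let $\omega'$ be the differential on $E'$ that pulls back to $\omega$. The value is $[(E',C',a^{-1}\omega')]$. Call $\phi$ oriented if there are a surjective holomorphic homomorphism $u:\mathbb C\to E$ and $\psi\in\mathcal L_{\mathbb Q}$ with $\ker u=L_\psi$ and $\phi(x,y)=u(\psi(x/n\delta,y/n\delta))$ for all $x,y\in\mathbb Z$. **Proposition.** Let $n\ge1$.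 1. For all $\gamma\in B(\Gamma_0(n))$ and $(L,L')\in\mathcal L_n$, the construction applied to $F_n(L,L')$ with oriented $\phi$ can be carried out, its value does not depend on any of the choices, and $$\gamma(F_n(L,L'))=F_n(\gamma(L,L')).$$ 2. Let $M$ be the set of integral matrices with lower left entry divisible by $n$ and determinant prime to $n$. If moreover $\gamma M\gamma^{-1}\subseteq M$, then the same holds with arbitrary $\phi$ (such that $\phi(0,\delta)$ generates $C$), oriented or not. 3. There is an injective map $j$ from $\Gamma_0(n)\backslash\mathbb H$ to the set of isomorphism classes of pairs $(E,C)$ such that, for every $\psi\in\mathcal L_{\mathbb Q}$, $j$ sends the class of $\psi(1,0)/\psi(0,1)$ to the class of $(\mathbb C/L_\psi,L_{\gamma_n\psi}/L_\psi)$; in particular it sends the class of $\tau$ to that of $(\mathbb C/(\mathbb Z\tau+\mathbb Z),\langle 1/n\rangle)$. It intertwines the action of $B(\Gamma_0(n))$ on $\Gamma_0(n)\backslash\mathbb H$ by Möbius transformations with the moduli action: for $\gamma\in B(\Gamma_0(n))$ and $y\in\Gamma_0(n)\backslash\mathbb H$, choosing any $\omega$ on a pair in the class $j(y)$, applying $\gamma$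 (with oriented $\phi$) and forgetting the differential always gives the class $j(\gamma y)$. -/

import Mathlib

open scoped Manifold ContDiff MatrixGroups UpperHalfPlane

noncomputable section

namespace Torus

variable (L : AddSubgroup ℂ)

theorem isLocalHomeomorph_mk [DiscreteTopology L] :
    IsLocalHomeomorph (QuotientAddGroup.mk : ℂ → ℂ ⧸ L) :=
  (AddSubgroup.isAddQuotientCoveringMap_of_comm L ⟨inferInstance⟩).isCoveringMap.isLocalHomeomorph

/-- The charts of `ℂ ⧸ L` are the local inverses of the projection `ℂ → ℂ ⧸ L`. -/
instance chartedSpace [DiscreteTopology L] : ChartedSpace ℂ (ℂ ⧸ L) :=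
  (isLocalHomeomorph_mk L).chartedSpace QuotientAddGroup.mk_surjective

variable {L}
variable [DiscreteTopology L]

theorem mk_atlas {e : OpenPartialHomeomorph (ℂ ⧸ L) ℂ} (he : e ∈ atlas ℂ (ℂ ⧸ L))
    {q : ℂ ⧸ L} (hq : q ∈ e.source) : (QuotientAddGroup.mk (e q) : ℂ ⧸ L) = q := by
  obtain ⟨p, rfl⟩ := he
  simp only [chartAt_self_eq, OpenPartialHomeomorph.trans_refl] at hq ⊢
  exact (isLocalHomeomorph_mk L).apply_localInverseAt_of_mem hq

theorem atlas_symm {e : OpenPartialHomeomorph (ℂ ⧸ L) ℂ} (he : e ∈ atlas ℂ (ℂ ⧸ L)) (z : ℂ) :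
    e.symm z = QuotientAddGroup.mk z := by
  obtain ⟨p, rfl⟩ := he
  simp only [chartAt_self_eq, OpenPartialHomeomorph.trans_refl]
  exact congrFun ((isLocalHomeomorph_mk L).localInverseAt_symm _) z

/-- A continuous local lift of the projection differs from the identity by a locally constant
element of the lattice. -/
theorem eventually_translate {s : ℂ → ℂ} {z : ℂ} (hs : ContinuousAt s z)
    (h : ∀ᶠ w in nhds z, (QuotientAddGroup.mk (s w) : ℂ ⧸ L) = QuotientAddGroup.mk w) :
    ∀ᶠ w in nhds z, s w = w + (s z - z) := by
  obtain ⟨U, hU, hUL⟩ : ∃ U ∈ nhds (0 : ℂ), ∀ x ∈ U, x ∈ L → x = 0 := by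
    have h0 : ({0} : Set L) ∈ nhds (0 : L) := (isOpen_discrete _).mem_nhds rfl
    rw [nhds_subtype_eq_comap] at h0
    obtain ⟨U, hU, hs⟩ := h0
    exact ⟨U, hU, fun x hx hxL => congrArg Subtype.val (hs (show (⟨x, hxL⟩ : L) ∈ _ from hx))⟩
  have hc : ContinuousAt (fun w => (s w - w) - (s z - z)) z := by fun_prop
  have h1 := hc.preimage_mem_nhds (t := U) (by simpa using hU)
  have hz := h.self_of_nhds
  filter_upwards [h1, h] with w hw hw'
  have e1 : s w - w ∈ L := by
    have := (QuotientAddGroup.eq_iff_sub_mem).1 hw'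
    exact this
  have e2 : s z - z ∈ L := (QuotientAddGroup.eq_iff_sub_mem).1 hz
  have := hUL _ hw (L.sub_mem e1 e2)
  linear_combination this

theorem chart_mk {e : OpenPartialHomeomorph (ℂ ⧸ L) ℂ} (he : e ∈ atlas ℂ (ℂ ⧸ L)) {z : ℂ}
    (hz : (QuotientAddGroup.mk z : ℂ ⧸ L) ∈ e.source) :
    ∀ᶠ w in nhds z, e (QuotientAddGroup.mk w) = w + (e (QuotientAddGroup.mk z) - z) := by
  have hcont : Continuous (QuotientAddGroup.mk : ℂ → ℂ ⧸ L) :=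
    (isLocalHomeomorph_mk L).continuous
  refine eventually_translate (L := L) (s := fun w => e (QuotientAddGroup.mk w)) ?_ ?_
  · exact ContinuousAt.comp (f := (QuotientAddGroup.mk : ℂ → ℂ ⧸ L))
      (e.continuousAt hz) hcont.continuousAt
  · filter_upwards [hcont.continuousAt.preimage_mem_nhds (e.open_source.mem_nhds hz)] with w hw
    exact mk_atlas he hw

instance isManifold : IsManifold 𝓘(ℂ, ℂ) ω (ℂ ⧸ L) := by
  refine isManifold_of_contDiffOn _ _ _ fun e e' he he' => ?_
  simp only [modelWithCornersSelf_coe, modelWithCornersSelf_coe_symm, Function.id_comp,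
    Function.comp_id, Set.preimage_id, Set.range_id, Set.inter_univ]
  intro z hz
  rw [OpenPartialHomeomorph.trans_source, OpenPartialHomeomorph.symm_source] at hz
  have hz2 : e.symm z ∈ e'.source := hz.2
  rw [atlas_symm he] at hz2
  have h := chart_mk he' hz2
  refine ContDiffAt.contDiffWithinAt ?_
  refine (ContDiffAt.congr_of_eventuallyEq (f := fun w => w + (e' (QuotientAddGroup.mk z) - z))
    (by fun_prop) ?_)
  filter_upwards [h] with w hw
  rw [OpenPartialHomeomorph.coe_trans, Function.comp_apply, atlas_symm he, hw]

theorem contMDiff_mk : ContMDiff 𝓘(ℂ, ℂ) 𝓘(ℂ, ℂ) ω (QuotientAddGroup.mk : ℂ → ℂ ⧸ L) := by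
  intro z
  set q : ℂ ⧸ L := QuotientAddGroup.mk z
  have h := chart_mk (chart_mem_atlas ℂ q) (mem_chart_source ℂ q)
  have hcont : Continuous (QuotientAddGroup.mk : ℂ → ℂ ⧸ L) :=
    (isLocalHomeomorph_mk L).continuous
  rw [contMDiffAt_iff]
  refine ⟨hcont.continuousAt, ContDiffAt.contDiffWithinAt ?_⟩
  refine (ContDiffAt.congr_of_eventuallyEq
    (f := fun w => w + (chartAt ℂ q q - z)) (by fun_prop) ?_)
  simpa [Function.comp_def] using! h

instance lieAddGroup : LieAddGroup 𝓘(ℂ, ℂ) ω (ℂ ⧸ L) where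
  contMDiff_add := by
    rintro ⟨p, q⟩
    have h1 : ContMDiffAt 𝓘(ℂ, ℂ) 𝓘(ℂ, ℂ) ω (chartAt ℂ p) p :=
      (contMDiffOn_chart (I := 𝓘(ℂ, ℂ)) (x := p)).contMDiffAt
        ((chartAt ℂ p).open_source.mem_nhds (mem_chart_source ℂ p))
    have h2 : ContMDiffAt 𝓘(ℂ, ℂ) 𝓘(ℂ, ℂ) ω (chartAt ℂ q) q :=
      (contMDiffOn_chart (I := 𝓘(ℂ, ℂ)) (x := q)).contMDiffAt
        ((chartAt ℂ q).open_source.mem_nhds (mem_chart_source ℂ q))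
    have h3 : ContMDiffAt (𝓘(ℂ, ℂ).prod 𝓘(ℂ, ℂ)) 𝓘(ℂ, ℂ) ω
        (fun x : (ℂ ⧸ L) × (ℂ ⧸ L) =>
          (QuotientAddGroup.mk (chartAt ℂ p x.1 + chartAt ℂ q x.2) : ℂ ⧸ L)) (p, q) :=
      contMDiff_mk.contMDiffAt.comp (p, q)
        ((ContMDiffAt.comp (p, q) (g := chartAt ℂ p) h1 contMDiffAt_fst).add
          (ContMDiffAt.comp (p, q) (g := chartAt ℂ q) h2 contMDiffAt_snd))
    refine h3.congr_of_eventuallyEq ?_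
    filter_upwards [prod_mem_nhds ((chartAt ℂ p).open_source.mem_nhds (mem_chart_source ℂ p))
      ((chartAt ℂ q).open_source.mem_nhds (mem_chart_source ℂ q))] with x hx
    rw [QuotientAddGroup.mk_add, mk_atlas (chart_mem_atlas ℂ p) hx.1,
      mk_atlas (chart_mem_atlas ℂ q) hx.2]
  contMDiff_neg := by
    intro p
    have h1 : ContMDiffAt 𝓘(ℂ, ℂ) 𝓘(ℂ, ℂ) ω (chartAt ℂ p) p :=
      (contMDiffOn_chart (I := 𝓘(ℂ, ℂ)) (x := p)).contMDiffAt
        ((chartAt ℂ p).open_source.mem_nhds (mem_chart_source ℂ p))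
    have h3 : ContMDiffAt 𝓘(ℂ, ℂ) 𝓘(ℂ, ℂ) ω
        (fun x : ℂ ⧸ L => (QuotientAddGroup.mk (-(chartAt ℂ p x)) : ℂ ⧸ L)) p :=
      contMDiff_mk.contMDiffAt.comp p h1.neg
    refine h3.congr_of_eventuallyEq ?_
    filter_upwards [(chartAt ℂ p).open_source.mem_nhds (mem_chart_source ℂ p)] with x hx
    rw [QuotientAddGroup.mk_neg, mk_atlas (chart_mem_atlas ℂ p) hx]

/-- In the charts of `ℂ ⧸ L` the projection has derivative `1`. -/
theorem mfderiv_mk (z : ℂ) :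
    mfderiv 𝓘(ℂ, ℂ) 𝓘(ℂ, ℂ) (QuotientAddGroup.mk : ℂ → ℂ ⧸ L) z = ContinuousLinearMap.id ℂ ℂ := by
  set q : ℂ ⧸ L := QuotientAddGroup.mk z
  have h := chart_mk (chart_mem_atlas ℂ q) (mem_chart_source ℂ q)
  have hd : MDifferentiableAt 𝓘(ℂ, ℂ) 𝓘(ℂ, ℂ) (QuotientAddGroup.mk : ℂ → ℂ ⧸ L) z :=
    (contMDiff_mk.contMDiffAt).mdifferentiableAt (by simp)
  rw [hd.mfderiv]
  have h2 : (writtenInExtChartAt 𝓘(ℂ, ℂ) 𝓘(ℂ, ℂ) z (QuotientAddGroup.mk : ℂ → ℂ ⧸ L)) =ᶠ[nhds z]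
      fun w => w + (chartAt ℂ q q - z) := by
    simpa [writtenInExtChartAt, Function.comp_def] using! h
  have h3 := h2.fderiv_eq (𝕜 := ℂ)
  simp only [fderiv_add_const, fderiv_fun_id] at h3
  rw [modelWithCornersSelf_coe, Set.range_id, fderivWithin_univ]
  exact h3

/-- The differential `c dz` on `ℂ ⧸ L`: its pull-back to `ℂ` is `c dz`, see `form_comp_mfderiv_mk`. -/
def form (c : ℂ) (x : ℂ ⧸ L) : TangentSpace 𝓘(ℂ, ℂ) x →L[ℂ] ℂ :=
  c • ContinuousLinearMap.id ℂ ℂ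

theorem form_comp_mfderiv_mk (c z v : ℂ) :
    form c (QuotientAddGroup.mk z : ℂ ⧸ L)
      (mfderiv 𝓘(ℂ, ℂ) 𝓘(ℂ, ℂ) (QuotientAddGroup.mk : ℂ → ℂ ⧸ L) z v) = c * v := by
  rw [mfderiv_mk]
  rfl

theorem contMDiff_form (c : ℂ) :
    ContMDiff 𝓘(ℂ, ℂ).tangent 𝓘(ℂ, ℂ) ω
      (fun v : TangentBundle 𝓘(ℂ, ℂ) (ℂ ⧸ L) => form c v.1 v.2) := by
  intro v₀
  have h1 := (Bundle.contMDiffAt_totalSpace (F := ℂ) (E := TangentSpace 𝓘(ℂ, ℂ)) (M := TangentBundle 𝓘(ℂ, ℂ) (ℂ ⧸ L)) (IM := 𝓘(ℂ, ℂ).tangent)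
    (IB := 𝓘(ℂ, ℂ)) (n := ω)
    (f := fun v : TangentBundle 𝓘(ℂ, ℂ) (ℂ ⧸ L) => v) (x₀ := v₀)).1 contMDiffAt_id |>.2
  have h2 : ContMDiffAt 𝓘(ℂ, ℂ).tangent 𝓘(ℂ, ℂ) ω
      (fun v : TangentBundle 𝓘(ℂ, ℂ) (ℂ ⧸ L) => c *
        (trivializationAt ℂ (TangentSpace 𝓘(ℂ, ℂ)) v₀.proj v).2) v₀ :=
    (contMDiffAt_const.mul h1)
  refine h2.congr_of_eventuallyEq ?_
  have h3 : {v : TangentBundle 𝓘(ℂ, ℂ) (ℂ ⧸ L) | v.proj ∈ (chartAt ℂ v₀.proj).source} ∈ nhds v₀ :=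
    (FiberBundle.continuous_proj ℂ (TangentSpace 𝓘(ℂ, ℂ))).continuousAt.preimage_mem_nhds
      ((chartAt ℂ v₀.proj).open_source.mem_nhds (mem_chart_source ℂ _))
  filter_upwards [h3] with v hv
  rw [TangentBundle.trivializationAt_apply]
  set z : ℂ := chartAt ℂ v.proj v.proj
  have hz : (QuotientAddGroup.mk z : ℂ ⧸ L) = v.proj :=
    mk_atlas (chart_mem_atlas ℂ _) (mem_chart_source ℂ _)
  have h4 := chart_mk (L := L) (z := z) (chart_mem_atlas ℂ v₀.proj) (by rw [hz]; exact hv)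
  have h5 : ((chartAt ℂ v₀.proj).extend 𝓘(ℂ, ℂ) ∘ ((chartAt ℂ v.proj).extend 𝓘(ℂ, ℂ)).symm)
      =ᶠ[nhds z] fun w => w + (chartAt ℂ v₀.proj (QuotientAddGroup.mk z : ℂ ⧸ L) - z) := by
    filter_upwards [h4] with w hw
    simp only [Function.comp_apply, OpenPartialHomeomorph.extend_coe,
      OpenPartialHomeomorph.extend_coe_symm, modelWithCornersSelf_coe,
      modelWithCornersSelf_coe_symm, id_eq]
    rw [atlas_symm (chart_mem_atlas ℂ _), hw]
  have h6 := h5.fderiv_eq (𝕜 := ℂ)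
  simp only [fderiv_add_const, fderiv_fun_id] at h6
  simp only [modelWithCornersSelf_coe, Set.range_id, fderivWithin_univ,
    OpenPartialHomeomorph.extend_coe, Function.comp_apply, id_eq] at h6 ⊢
  rw [h6]
  rfl

end Torus

/-- A lattice in `ℂ`: a discrete subgroup that spans `ℂ` over `ℝ`. -/
structure IsLattice (L : AddSubgroup ℂ) : Prop where
  discrete : DiscreteTopology L
  span_top : Submodule.span ℝ (L : Set ℂ) = ⊤

/-- Homomorphisms `ψ : ℚ² → ℂ` such that `ψ(ℤ²)` is a positively oriented lattice.  Since division
by zero is zero, the condition includes that `ψ(1,0)` and `ψ(0,1)` are `ℝ`-linearly independent. -/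
structure LQ where
  hom : (Fin 2 → ℚ) →+ ℂ
  pos : 0 < (hom ![1, 0] / hom ![0, 1]).im

namespace LQ

/-- The lattice `L_ψ = ψ(ℤ²) = ℤ ψ(1,0) + ℤ ψ(0,1)`. -/
def lattice (ψ : LQ) : AddSubgroup ℂ := AddSubgroup.closure {ψ.1 ![1, 0], ψ.1 ![0, 1]}

theorem mem_lattice {ψ : LQ} {z : ℂ} :
    z ∈ ψ.lattice ↔ ∃ x y : ℤ, x * ψ.1 ![1, 0] + y * ψ.1 ![0, 1] = z := by
  rw [lattice, AddSubgroup.mem_closure_pair]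
  simp [zsmul_eq_mul]

theorem apply (ψ : LQ) (v : Fin 2 → ℚ) : ψ.1 v = v 0 * ψ.1 ![1, 0] + v 1 * ψ.1 ![0, 1] := by
  have h : v = v 0 • ![1, 0] + v 1 • ![0, 1] := by ext i; fin_cases i <;> simp
  conv_lhs => rw [h]
  rw [map_add, map_rat_smul, map_rat_smul, Rat.smul_def, Rat.smul_def]

protected theorem ext {ψ ψ' : LQ} (h0 : ψ.1 ![1, 0] = ψ'.1 ![1, 0])
    (h1 : ψ.1 ![0, 1] = ψ'.1 ![0, 1]) : ψ = ψ' := by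
  have h : ψ.1 = ψ'.1 := AddMonoidHom.ext fun v => by rw [ψ.apply, ψ'.apply, h0, h1]
  cases ψ
  cases ψ'
  cases h
  rfl

theorem snd_ne (ψ : LQ) : ψ.1 ![0, 1] ≠ 0 := fun h => by
  have := ψ.2
  simp [h] at this

/-- The element of `LQ` with given values at `(1,0)` and `(0,1)`. -/
def ofPair (z w : ℂ) (h : 0 < (z / w).im) : LQ :=
  ⟨{ toFun := fun v => v 0 * z + v 1 * w
     map_zero' := by simp
     map_add' := fun v v' => by simp; ring }, by simpa using! h⟩

@[simp] theorem ofPair_fst (z w : ℂ) (h) : (ofPair z w h).1 ![1, 0] = z := by simp [ofPair]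
@[simp] theorem ofPair_snd (z w : ℂ) (h) : (ofPair z w h).1 ![0, 1] = w := by simp [ofPair]

theorem eq_zero_of_real (ψ : LQ) {x y : ℝ} (h : x * ψ.1 ![1, 0] + y * ψ.1 ![0, 1] = 0) :
    x = 0 ∧ y = 0 := by
  have hw := ψ.snd_ne
  have h1 : (x : ℂ) * (ψ.1 ![1, 0] / ψ.1 ![0, 1]) + y = 0 := by
    field_simp
    linear_combination h
  have h2 := congrArg Complex.im h1
  simp only [Complex.add_im, Complex.mul_im, Complex.ofReal_re, Complex.ofReal_im, zero_mul,
    add_zero, Complex.zero_im, mul_eq_zero] at h2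
  have hx : x = 0 := h2.resolve_right ψ.2.ne'
  refine ⟨hx, ?_⟩
  rw [hx] at h1
  simpa using h1

theorem int_ext (ψ : LQ) {x y x' y' : ℤ} (h : (x : ℂ) * ψ.1 ![1, 0] + y * ψ.1 ![0, 1]
    = x' * ψ.1 ![1, 0] + y' * ψ.1 ![0, 1]) : x = x' ∧ y = y' := by
  have := ψ.eq_zero_of_real (x := (x - x' : ℤ)) (y := (y - y' : ℤ)) (by
    push_cast; linear_combination h)
  norm_cast at this
  omega

theorem det_pos (γ : GL(2, ℚ)⁺) : 0 < (γ.1 : Matrix (Fin 2) (Fin 2) ℚ).det := γ.2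

theorem im_formula (a b c d : ℝ) (z w : ℂ) (hw : w ≠ 0) :
    ((a * z + b * w) / (c * z + d * w)).im =
      (a * d - b * c) * (z / w).im / Complex.normSq (c * (z / w) + d) := by
  have e : (a * z + b * w) / (c * z + d * w) = (a * (z / w) + b) / (c * (z / w) + d) := by
    rw [← mul_div_mul_right (a * (z / w) + b) _ hw]
    congr 1 <;> field_simp
  rw [e, Complex.div_im]
  simp only [Complex.add_im, Complex.mul_im, Complex.add_re, Complex.mul_re, Complex.ofReal_re,
    Complex.ofReal_im]
  ring

/-- The left action `(γψ)(v) = (det γ)⁻¹ ψ(vγ)` of `GL₂(ℚ)⁺`. -/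
instance : SMul GL(2, ℚ)⁺ LQ where
  smul γ ψ := ⟨((AddMonoidHom.mulLeft
      ((((γ.1 : Matrix (Fin 2) (Fin 2) ℚ).det : ℚ) : ℂ)⁻¹)).comp ψ.1).comp
        (γ.1 : Matrix (Fin 2) (Fin 2) ℚ).vecMulLinear.toAddMonoidHom, by
    set A := (γ.1 : Matrix (Fin 2) (Fin 2) ℚ) with hA
    have hdet := det_pos γ
    have hdet' : ((A.det : ℚ) : ℂ)⁻¹ ≠ 0 := by
      simpa using hdet.ne'
    have hw := ψ.snd_ne
    simp only [AddMonoidHom.comp_apply, LinearMap.toAddMonoidHom_coe, Matrix.vecMulLinear_apply,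
      AddMonoidHom.coe_mulLeft, mul_div_mul_left _ _ hdet']
    rw [ψ.apply (Matrix.vecMul ![1, 0] A), ψ.apply (Matrix.vecMul ![0, 1] A)]
    have h := im_formula (A 0 0) (A 0 1) (A 1 0) (A 1 1) (ψ.1 ![1, 0]) (ψ.1 ![0, 1]) hw
    simp only [Complex.ofReal_ratCast] at h
    simp only [Matrix.vecMul, dotProduct, Fin.sum_univ_two, Matrix.cons_val_zero,
      Matrix.cons_val_one, one_mul, zero_mul, add_zero, zero_add]
    rw [h]
    have hd : (0 : ℝ) < A 0 0 * A 1 1 - A 0 1 * A 1 0 := by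
      rw [← hA, Matrix.det_fin_two] at hdet
      exact_mod_cast hdet
    refine div_pos (mul_pos hd ψ.2) (Complex.normSq_pos.2 fun h0 => ?_)
    have h1 := ψ.eq_zero_of_real (x := A 1 0) (y := A 1 1) (by
      field_simp at h0
      linear_combination h0)
    simp [h1.1, h1.2] at hd⟩

theorem smul_apply (γ : GL(2, ℚ)⁺) (ψ : LQ) (v : Fin 2 → ℚ) :
    (γ • ψ).1 v = (((γ.1 : Matrix (Fin 2) (Fin 2) ℚ).det : ℚ) : ℂ)⁻¹ *
      ψ.1 (Matrix.vecMul v (γ.1 : Matrix (Fin 2) (Fin 2) ℚ)) := rfl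

instance : MulAction GL(2, ℚ)⁺ LQ where
  one_smul ψ := LQ.ext (by rw [smul_apply]; simp) (by rw [smul_apply]; simp)
  mul_smul γ γ' ψ := by
    apply LQ.ext <;>
    simp only [smul_apply, Subgroup.coe_mul, Units.val_mul, Matrix.det_mul, Rat.cast_mul, mul_inv,
      Matrix.vecMul_vecMul] <;>
    ring

theorem smul_fst (γ : GL(2, ℚ)⁺) (ψ : LQ) : (γ • ψ).1 ![1, 0] =
    (((γ.1 : Matrix (Fin 2) (Fin 2) ℚ).det : ℚ) : ℂ)⁻¹ *
      (γ.1.1 0 0 * ψ.1 ![1, 0] + γ.1.1 0 1 * ψ.1 ![0, 1]) := by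
  rw [smul_apply, ψ.apply]
  simp [Matrix.vecMul, dotProduct]

theorem smul_snd (γ : GL(2, ℚ)⁺) (ψ : LQ) : (γ • ψ).1 ![0, 1] =
    (((γ.1 : Matrix (Fin 2) (Fin 2) ℚ).det : ℚ) : ℂ)⁻¹ *
      (γ.1.1 1 0 * ψ.1 ![1, 0] + γ.1.1 1 1 * ψ.1 ![0, 1]) := by
  rw [smul_apply, ψ.apply]
  simp [Matrix.vecMul, dotProduct]

/-- `L_ψ` is a lattice, and every lattice is of the form `L_ψ`. -/
theorem isLattice (ψ : LQ) : IsLattice ψ.lattice := by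
  let P : PeriodPair := ⟨ψ.1 ![1, 0], ψ.1 ![0, 1], LinearIndependent.pair_iff.2 fun s t h =>
    ψ.eq_zero_of_real (by simpa using h)⟩
  have hP : P.lattice.toAddSubgroup = ψ.lattice := by
    ext z
    rw [mem_lattice]
    exact PeriodPair.mem_lattice
  constructor
  · rw [← hP]
    exact inferInstanceAs (DiscreteTopology P.lattice)
  · rw [← hP]
    exact IsZLattice.span_top (K := ℝ) (L := P.lattice)

theorem exists_lattice_eq {L : AddSubgroup ℂ} (hL : IsLattice L) : ∃ ψ : LQ, ψ.lattice = L := by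
  let M : Submodule ℤ ℂ := AddSubgroup.toIntSubmodule L
  have : DiscreteTopology M := hL.discrete
  have : IsZLattice ℝ M := ⟨hL.span_top⟩
  have := ZLattice.module_free ℝ M
  have := ZLattice.module_finite ℝ M
  have hr : Module.finrank ℤ M = 2 := by rw [ZLattice.rank ℝ M, Complex.finrank_real_complex]
  let b : Module.Basis (Fin 2) ℤ M := Module.finBasisOfFinrankEq ℤ M hr
  have hli := (b.ofZLatticeBasis ℝ M).linearIndependent
  have hmem : ∀ z, z ∈ L ↔ ∃ x y : ℤ, x * (b 0 : ℂ) + y * (b 1 : ℂ) = z := by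
    intro z
    constructor
    · intro hz
      refine ⟨b.repr ⟨z, hz⟩ 0, b.repr ⟨z, hz⟩ 1, ?_⟩
      have := congrArg (M.subtype) (b.sum_repr ⟨z, hz⟩)
      rw [Fin.sum_univ_two, map_add, map_zsmul, map_zsmul, zsmul_eq_mul, zsmul_eq_mul] at this
      exact this
    · rintro ⟨x, y, rfl⟩
      rw [← zsmul_eq_mul, ← zsmul_eq_mul]
      exact L.add_mem (L.zsmul_mem (b 0).2 _) (L.zsmul_mem (b 1).2 _)
  have hli' : ∀ s t : ℝ, s * (b 0 : ℂ) + t * (b 1 : ℂ) = 0 → s = 0 ∧ t = 0 := by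
    intro s t h
    have h2 := Fintype.linearIndependent_iff.1 hli ![s, t] (by
      simpa [Fin.sum_univ_two] using h)
    exact ⟨h2 0, h2 1⟩
  have hb1 : (b 1 : ℂ) ≠ 0 := fun h => by
    have := (hli' 0 1 (by simp [h])).2
    norm_num at this
  have him : ((b 0 : ℂ) / b 1).im ≠ 0 := fun h => by
    have h1 : (b 0 : ℂ) / b 1 = (((b 0 : ℂ) / b 1).re : ℂ) := Complex.ext (by simp) (by simp [h])
    have := (hli' 1 (-((b 0 : ℂ) / b 1).re) (by
      push_cast
      rw [← h1]
      field_simp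
      ring)).1
    norm_num at this
  rcases lt_or_gt_of_ne him with h | h
  · refine ⟨ofPair (-(b 0 : ℂ)) (b 1) (by rw [neg_div, Complex.neg_im]; linarith), ?_⟩
    ext z
    rw [mem_lattice, hmem]
    simp only [ofPair_fst, ofPair_snd]
    constructor
    · rintro ⟨x, y, rfl⟩
      exact ⟨-x, y, by push_cast; ring⟩
    · rintro ⟨x, y, rfl⟩
      exact ⟨-x, y, by push_cast; ring⟩
  · refine ⟨ofPair (b 0 : ℂ) (b 1) h, ?_⟩
    ext z
    rw [mem_lattice, hmem]
    simp only [ofPair_fst, ofPair_snd]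

end LQ

open CongruenceSubgroup in
/-- `Γ₀(n)` as a subgroup of `GL₂(ℚ)⁺`. -/
def Gamma0Q (n : ℕ) : Subgroup GL(2, ℚ)⁺ :=
  (Gamma0 n).map (Matrix.SpecialLinearGroup.toGLPos.comp
    (Matrix.SpecialLinearGroup.map (Int.castRingHom ℚ)))

/-- `B(Γ₀(n))`, the normalizer of `Γ₀(n)` in `GL₂(ℚ)⁺`. -/
def BGamma0 (n : ℕ) : Subgroup GL(2, ℚ)⁺ := Subgroup.normalizer (Gamma0Q n : Set GL(2, ℚ)⁺)

theorem mem_Gamma0Q {n : ℕ} {γ : GL(2, ℚ)⁺} : γ ∈ Gamma0Q n ↔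
    ∃ g : Matrix (Fin 2) (Fin 2) ℤ, g.det = 1 ∧ (n : ℤ) ∣ g 1 0 ∧
      (γ.1 : Matrix (Fin 2) (Fin 2) ℚ) = g.map (Int.cast : ℤ → ℚ) := by
  constructor
  · rintro ⟨g, hg, rfl⟩
    exact ⟨g.1, g.2, (ZMod.intCast_zmod_eq_zero_iff_dvd _ _).1 (CongruenceSubgroup.Gamma0_mem.1 hg), rfl⟩
  · rintro ⟨g, hg, hn, h⟩
    refine ⟨⟨g, hg⟩, CongruenceSubgroup.Gamma0_mem.2 ((ZMod.intCast_zmod_eq_zero_iff_dvd _ _).2 hn), ?_⟩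
    exact Subtype.ext (Units.ext h.symm)

/-- The matrix `γ_n = diag(n, 1)`. -/
def gammaN (n : ℕ) [NeZero n] : GL(2, ℚ)⁺ :=
  ⟨Matrix.GeneralLinearGroup.mkOfDetNeZero !![(n : ℚ), 0; 0, 1]
    (by simpa using NeZero.ne n), by
      change 0 < (!![(n : ℚ), 0; 0, 1] : Matrix (Fin 2) (Fin 2) ℚ).det
      simpa using Nat.pos_of_ne_zero (NeZero.ne n)⟩

/-- The set `𝓛_n` of pairs of lattices `(L, L')` in `ℂ` such that `L ⊆ L'` and the subgroup `L'/L`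
of `ℂ/L` is cyclic of order `n`. -/
structure Ln (n : ℕ) where
  L : AddSubgroup ℂ
  L' : AddSubgroup ℂ
  isLattice : IsLattice L
  isLattice' : IsLattice L'
  le : L ≤ L'
  cyclic : IsAddCyclic (L'.map (QuotientAddGroup.mk' L))
  card : Nat.card (L'.map (QuotientAddGroup.mk' L)) = n

namespace Ln

variable {n : ℕ}

protected theorem ext {p q : Ln n} (h : p.L = q.L) (h' : p.L' = q.L') : p = q := by
  cases p
  cases q
  cases h
  cases h'
  rfl

variable [NeZero n]

theorem gammaN_fst (ψ : LQ) : (gammaN n • ψ).1 ![1, 0] = ψ.1 ![1, 0] := by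
  have hn : (n : ℂ) ≠ 0 := by exact_mod_cast NeZero.ne n
  rw [LQ.smul_fst]
  simp [gammaN, Matrix.GeneralLinearGroup.mkOfDetNeZero, hn]

theorem gammaN_snd (ψ : LQ) : (gammaN n • ψ).1 ![0, 1] = (n : ℂ)⁻¹ * ψ.1 ![0, 1] := by
  rw [LQ.smul_snd]
  simp [gammaN, Matrix.GeneralLinearGroup.mkOfDetNeZero]

theorem mem_lattice_gammaN {ψ : LQ} {z : ℂ} : z ∈ (gammaN n • ψ).lattice ↔
    ∃ x y : ℤ, x * ψ.1 ![1, 0] + y * ((n : ℂ)⁻¹ * ψ.1 ![0, 1]) = z := by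
  rw [LQ.mem_lattice, gammaN_fst, gammaN_snd]

theorem map_eq_zmultiples (ψ : LQ) :
    (gammaN n • ψ).lattice.map (QuotientAddGroup.mk' ψ.lattice) =
      AddSubgroup.zmultiples (QuotientAddGroup.mk' ψ.lattice ((n : ℂ)⁻¹ * ψ.1 ![0, 1])) := by
  have h0 : QuotientAddGroup.mk' ψ.lattice (ψ.1 ![1, 0]) = 0 :=
    (QuotientAddGroup.eq_zero_iff _).2 (LQ.mem_lattice.2 ⟨1, 0, by simp⟩)
  ext q
  rw [AddSubgroup.mem_map, AddSubgroup.mem_zmultiples_iff]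
  constructor
  · rintro ⟨z, hz, rfl⟩
    obtain ⟨x, y, rfl⟩ := mem_lattice_gammaN.1 hz
    refine ⟨y, ?_⟩
    rw [← zsmul_eq_mul, ← zsmul_eq_mul, map_add, map_zsmul, map_zsmul, h0, smul_zero, zero_add]
  · rintro ⟨y, rfl⟩
    refine ⟨y • ((n : ℂ)⁻¹ * ψ.1 ![0, 1]), mem_lattice_gammaN.2 ⟨0, y, by simp⟩, map_zsmul _ _ _⟩

theorem addOrderOf_eq (ψ : LQ) :
    addOrderOf (QuotientAddGroup.mk' ψ.lattice ((n : ℂ)⁻¹ * ψ.1 ![0, 1])) = n := by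
  have hn : (n : ℂ) ≠ 0 := by exact_mod_cast NeZero.ne n
  have key : ∀ m : ℕ, m • (QuotientAddGroup.mk' ψ.lattice ((n : ℂ)⁻¹ * ψ.1 ![0, 1])) = 0 ↔ n ∣ m := by
    intro m
    rw [← map_nsmul, nsmul_eq_mul]
    refine (QuotientAddGroup.eq_zero_iff _).trans ?_
    rw [LQ.mem_lattice]
    constructor
    · rintro ⟨x, y, h⟩
      have := ψ.int_ext (x := n * x) (y := n * y) (x' := 0) (y' := m) (by
        push_cast
        field_simp at h
        linear_combination h)
      exact Int.natCast_dvd_natCast.1 ⟨y, this.2.symm⟩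
    · rintro ⟨k, rfl⟩
      refine ⟨0, k, ?_⟩
      push_cast
      field_simp
      ring
  exact Nat.dvd_antisymm (addOrderOf_dvd_iff_nsmul_eq_zero.2 ((key n).2 dvd_rfl))
    ((key _).1 (addOrderOf_nsmul_eq_zero _))

/-- The map `π_n : ψ ↦ (L_ψ, L_{γ_n ψ})`. -/
def pi (n : ℕ) [NeZero n] (ψ : LQ) : Ln n where
  L := ψ.lattice
  L' := (gammaN n • ψ).lattice
  isLattice := ψ.isLattice
  isLattice' := (gammaN n • ψ).isLattice
  le := by
    have hn : (n : ℂ) ≠ 0 := by exact_mod_cast NeZero.ne n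
    intro z hz
    obtain ⟨x, y, rfl⟩ := LQ.mem_lattice.1 hz
    refine mem_lattice_gammaN.2 ⟨x, y * n, ?_⟩
    push_cast
    field_simp
  cyclic := by
    rw [map_eq_zmultiples]
    infer_instance
  card := by rw [map_eq_zmultiples, Nat.card_zmultiples, addOrderOf_eq]

theorem pi_le {γ : GL(2, ℚ)⁺} (hγ : γ ∈ Gamma0Q n) (ψ : LQ) :
    (pi n (γ • ψ)).L ≤ (pi n ψ).L ∧ (pi n (γ • ψ)).L' ≤ (pi n ψ).L' := by
  have hn : (n : ℂ) ≠ 0 := by exact_mod_cast NeZero.ne n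
  obtain ⟨g, hg, ⟨k, hk⟩, h⟩ := mem_Gamma0Q.1 hγ
  have hd : (γ.1 : Matrix (Fin 2) (Fin 2) ℚ).det = 1 := by
    rw [h, show g.map (Int.cast : ℤ → ℚ) = (Int.castRingHom ℚ).mapMatrix g from rfl,
      ← RingHom.map_det, hg, map_one]
  have e0 : (γ • ψ).1 ![1, 0] = g 0 0 * ψ.1 ![1, 0] + g 0 1 * ψ.1 ![0, 1] := by
    rw [LQ.smul_fst, hd, h]
    simp
  have e1 : (γ • ψ).1 ![0, 1] = (n * k) * ψ.1 ![1, 0] + g 1 1 * ψ.1 ![0, 1] := by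
    rw [LQ.smul_snd, hd, h]
    simp [hk]
  constructor
  · intro z hz
    obtain ⟨x, y, rfl⟩ := LQ.mem_lattice.1 hz
    refine LQ.mem_lattice.2 ⟨x * g 0 0 + y * (n * k), x * g 0 1 + y * g 1 1, ?_⟩
    rw [e0, e1]
    push_cast
    ring
  · intro z hz
    obtain ⟨x, y, rfl⟩ := mem_lattice_gammaN.1 hz
    refine mem_lattice_gammaN.2 ⟨x * g 0 0 + y * k, x * n * g 0 1 + y * g 1 1, ?_⟩
    rw [e0, e1]
    push_cast
    field_simp
    ring

theorem pi_smul_of_mem {γ : GL(2, ℚ)⁺} (hγ : γ ∈ Gamma0Q n) (ψ : LQ) : pi n (γ • ψ) = pi n ψ := by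
  have h1 := pi_le hγ ψ
  have h2 := pi_le (inv_mem hγ) (γ • ψ)
  rw [inv_smul_smul] at h2
  exact Ln.ext (le_antisymm h1.1 h2.1) (le_antisymm h1.2 h2.2)

theorem exists_of_pi_eq {ψ ψ' : LQ} (h : pi n ψ = pi n ψ') : ∃ γ ∈ Gamma0Q n, γ • ψ = ψ' := by
  have hn : (n : ℂ) ≠ 0 := by exact_mod_cast NeZero.ne n
  have hL : ψ.lattice = ψ'.lattice := congrArg Ln.L h
  have hL' : (gammaN n • ψ).lattice = (gammaN n • ψ').lattice := congrArg Ln.L' h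
  obtain ⟨a, b, hab⟩ := LQ.mem_lattice.1 (hL ▸ LQ.mem_lattice.2 ⟨1, 0, by simp⟩ : ψ'.1 ![1, 0] ∈ ψ.lattice)
  obtain ⟨c, d, hcd⟩ := LQ.mem_lattice.1 (hL ▸ LQ.mem_lattice.2 ⟨0, 1, by simp⟩ : ψ'.1 ![0, 1] ∈ ψ.lattice)
  obtain ⟨a', b', hab'⟩ := LQ.mem_lattice.1 (hL ▸ LQ.mem_lattice.2 ⟨1, 0, by simp⟩ : ψ.1 ![1, 0] ∈ ψ'.lattice)
  obtain ⟨c', d', hcd'⟩ := LQ.mem_lattice.1 (hL ▸ LQ.mem_lattice.2 ⟨0, 1, by simp⟩ : ψ.1 ![0, 1] ∈ ψ'.lattice)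
  obtain ⟨k, l, hkl⟩ := mem_lattice_gammaN.1 (hL' ▸ mem_lattice_gammaN.2 ⟨0, 1, by simp⟩ :
    (n : ℂ)⁻¹ * ψ'.1 ![0, 1] ∈ (gammaN n • ψ).lattice)
  have r1 := ψ.int_ext (x := a' * a + b' * c) (y := a' * b + b' * d) (x' := 1) (y' := 0) (by
    push_cast
    linear_combination a' * hab + b' * hcd + hab')
  have r2 := ψ.int_ext (x := c' * a + d' * c) (y := c' * b + d' * d) (x' := 0) (y' := 1) (by
    push_cast
    linear_combination c' * hab + d' * hcd + hcd')
  have r3 := ψ.int_ext (x := n * k) (y := l) (x' := c) (y' := d) (by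
    push_cast
    field_simp at hkl
    linear_combination hkl - hcd)
  have hdd : (a' * d' - b' * c') * (a * d - b * c) = 1 := by
    obtain ⟨r11, r12⟩ := r1
    obtain ⟨r21, r22⟩ := r2
    linear_combination r11 * (c' * b + d' * d) + r22 - r12 * (c' * a + d' * c)
  have hpos : (0 : ℝ) < a * d - b * c := by
    have h1 := ψ'.pos
    rw [show ψ'.hom ![1, 0] = _ from hab.symm, show ψ'.hom ![0, 1] = _ from hcd.symm] at h1
    have h2 := LQ.im_formula a b c d (ψ.1 ![1, 0]) (ψ.1 ![0, 1]) ψ.snd_ne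
    simp only [Complex.ofReal_intCast] at h2
    rw [h2] at h1
    by_contra hneg
    refine absurd h1 (not_lt.2 (div_nonpos_of_nonpos_of_nonneg
      (mul_nonpos_of_nonpos_of_nonneg (not_lt.1 hneg) ψ.pos.le) (Complex.normSq_nonneg _)))
  have hdet : a * d - b * c = 1 := by
    have h1 : (0 : ℤ) < a * d - b * c := by exact_mod_cast hpos
    exact Int.eq_one_of_dvd_one h1.le ⟨_, by rw [mul_comm]; exact hdd.symm⟩
  have hg : (!![a, b; c, d] : Matrix (Fin 2) (Fin 2) ℤ).det = 1 := by
    rw [Matrix.det_fin_two_of, hdet]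
  let g : Matrix.SpecialLinearGroup (Fin 2) ℤ := ⟨!![a, b; c, d], hg⟩
  let γ : GL(2, ℚ)⁺ := Matrix.SpecialLinearGroup.toGLPos
    (Matrix.SpecialLinearGroup.map (Int.castRingHom ℚ) g)
  have hγ : (γ.1 : Matrix (Fin 2) (Fin 2) ℚ) = (!![a, b; c, d] : Matrix (Fin 2) (Fin 2) ℤ).map
    (Int.cast : ℤ → ℚ) := rfl
  have hγd : (γ.1 : Matrix (Fin 2) (Fin 2) ℚ).det = 1 :=
    (Matrix.SpecialLinearGroup.map (Int.castRingHom ℚ) g).2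
  refine ⟨γ, mem_Gamma0Q.2 ⟨_, hg, ⟨k, ?_⟩, hγ⟩, LQ.ext ?_ ?_⟩
  · simpa using r3.1.symm
  · rw [LQ.smul_fst, hγd, hγ]
    simpa using hab
  · rw [LQ.smul_snd, hγd, hγ]
    simpa using hcd

theorem pi_surjective : Function.Surjective (pi n) := by
  intro p
  have hn : (n : ℂ) ≠ 0 := by exact_mod_cast NeZero.ne n
  obtain ⟨ψ, hψ⟩ := LQ.exists_lattice_eq p.isLattice
  obtain ⟨q, hq⟩ := (AddSubgroup.isAddCyclic_iff_exists_zmultiples_eq_top _).1 p.cyclic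
  have hqm : q ∈ p.L'.map (QuotientAddGroup.mk' p.L) := hq ▸ AddSubgroup.mem_zmultiples q
  obtain ⟨x, hx, rfl⟩ := hqm
  have hord : addOrderOf (QuotientAddGroup.mk' p.L x) = n := by
    rw [← Nat.card_zmultiples, hq, p.card]
  have hmul : ∀ m : ℕ, (m : ℂ) * x ∈ p.L ↔ n ∣ m := by
    intro m
    refine Iff.trans ?_ (show addOrderOf (QuotientAddGroup.mk' p.L x) ∣ m ↔ n ∣ m by rw [hord])
    rw [addOrderOf_dvd_iff_nsmul_eq_zero, ← map_nsmul, nsmul_eq_mul]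
    exact (QuotientAddGroup.eq_zero_iff _).symm
  have hL' : ∀ z, z ∈ p.L' ↔ ∃ k : ℤ, z - k * x ∈ p.L := by
    intro z
    constructor
    · intro hz
      have h1 : QuotientAddGroup.mk' p.L z ∈ p.L'.map (QuotientAddGroup.mk' p.L) := ⟨z, hz, rfl⟩
      rw [← hq, AddSubgroup.mem_zmultiples_iff] at h1
      obtain ⟨k, hk⟩ := h1
      refine ⟨k, ?_⟩
      rw [← map_zsmul, zsmul_eq_mul] at hk
      exact (QuotientAddGroup.eq_iff_sub_mem).1 hk.symm
    · rintro ⟨k, hk⟩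
      have h1 := p.L'.add_mem (p.le hk) (p.L'.zsmul_mem hx k)
      rw [zsmul_eq_mul] at h1
      simpa using h1
  obtain ⟨r, s, hrs⟩ := LQ.mem_lattice.1 (hψ ▸ (hmul n).2 dvd_rfl : (n : ℂ) * x ∈ ψ.lattice)
  have hcop : Nat.Coprime (Int.gcd r s) n := by
    obtain ⟨m, hm⟩ := Nat.gcd_dvd_right (Int.gcd r s) n
    generalize hk : Nat.gcd (Int.gcd r s) n = k at hm ⊢
    have hkr : (k : ℤ) ∣ r := (Int.natCast_dvd_natCast.2 (hk ▸ Nat.gcd_dvd_left _ _)).trans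
      (Int.gcd_dvd_left _ _)
    have hks : (k : ℤ) ∣ s := (Int.natCast_dvd_natCast.2 (hk ▸ Nat.gcd_dvd_left _ _)).trans
      (Int.gcd_dvd_right _ _)
    obtain ⟨r₁, hr₁⟩ := hkr
    obtain ⟨s₁, hs₁⟩ := hks
    rw [hr₁, hs₁] at hrs
    have hn0 := NeZero.ne n
    have hk0 : (k : ℂ) ≠ 0 := by
      intro h
      have : k = 0 := by exact_mod_cast h
      rw [this, zero_mul] at hm
      exact hn0 hm
    have hmL : (m : ℂ) * x ∈ p.L := by
      rw [← hψ]
      refine LQ.mem_lattice.2 ⟨r₁, s₁, ?_⟩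
      apply mul_left_cancel₀ hk0
      have : (n : ℂ) = k * m := by exact_mod_cast hm
      rw [this] at hrs
      push_cast at hrs
      linear_combination hrs
    obtain ⟨t, ht⟩ := (hmul m).1 hmL
    have h1 : n * 1 = n * (k * t) := by
      calc n * 1 = k * m := by rw [mul_one, hm]
        _ = n * (k * t) := by rw [ht]; ring
    exact hk.trans (Nat.eq_one_of_mul_eq_one_right (Nat.eq_of_mul_eq_mul_left (Nat.pos_of_ne_zero hn0) h1).symm)
  obtain ⟨r', s', ⟨u, v, huv⟩, hr, hs⟩ : ∃ r' s' : ℤ, IsCoprime r' s' ∧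
      r = Int.gcd r s * r' ∧ s = Int.gcd r s * s' := by
    rcases Nat.eq_zero_or_pos (Int.gcd r s) with h | h
    · have h2 := Int.gcd_eq_zero_iff.1 h
      exact ⟨0, 1, isCoprime_one_right, by rw [h2.1, mul_zero], by rw [h, h2.2]; rfl⟩
    · obtain ⟨r', s', hc, hr, hs⟩ := Int.exists_gcd_one h
      exact ⟨r', s', Int.isCoprime_iff_gcd_eq_one.2 hc, by rw [mul_comm]; exact hr,
        by rw [mul_comm]; exact hs⟩
  obtain ⟨e, f, hef⟩ := Nat.isCoprime_iff_coprime.2 hcop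
  set d : ℤ := (Int.gcd r s : ℤ) with hd
  have hpos : 0 < ((v * ψ.1 ![1, 0] + (-u : ℤ) * ψ.1 ![0, 1]) /
      (r' * ψ.1 ![1, 0] + s' * ψ.1 ![0, 1])).im := by
    have h2 := LQ.im_formula v (-u : ℤ) r' s' (ψ.1 ![1, 0]) (ψ.1 ![0, 1]) ψ.snd_ne
    simp only [Complex.ofReal_intCast] at h2
    rw [h2]
    have h3 : (v : ℝ) * s' - (-u : ℤ) * r' = 1 := by
      have : v * s' - (-u) * r' = 1 := by linear_combination huv
      exact_mod_cast this
    rw [h3, one_mul]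
    refine div_pos ψ.pos (Complex.normSq_pos.2 fun h0 => ?_)
    have hw := ψ.snd_ne
    field_simp at h0
    have h4 := ψ.eq_zero_of_real (x := r') (y := s') (by
      push_cast
      linear_combination h0)
    have h5 : r' = 0 := by exact_mod_cast h4.1
    have h6 : s' = 0 := by exact_mod_cast h4.2
    simp [h5, h6] at huv
  have huv' : (u : ℂ) * r' + v * s' = 1 := by exact_mod_cast huv
  have hef' : (e : ℂ) * d + f * n = 1 := by exact_mod_cast hef
  have hr' : (r : ℂ) = d * r' := by exact_mod_cast hr
  have hs' : (s : ℂ) = d * s' := by exact_mod_cast hs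
  let ψ' : LQ := LQ.ofPair _ _ hpos
  have e0 : ψ'.1 ![1, 0] = v * ψ.1 ![1, 0] + (-u : ℤ) * ψ.1 ![0, 1] := LQ.ofPair_fst _ _ _
  have e1 : ψ'.1 ![0, 1] = r' * ψ.1 ![1, 0] + s' * ψ.1 ![0, 1] := LQ.ofPair_snd _ _ _
  have hψ' : ψ'.lattice = p.L := by
    rw [← hψ]
    ext z
    rw [LQ.mem_lattice, LQ.mem_lattice, e0, e1]
    constructor
    · rintro ⟨a, b, rfl⟩
      exact ⟨a * v + b * r', -a * u + b * s', by push_cast; ring⟩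
    · rintro ⟨a, b, rfl⟩
      refine ⟨a * s' - b * r', a * u + b * v, ?_⟩
      push_cast
      linear_combination (a * ψ.1 ![1, 0] + b * ψ.1 ![0, 1]) * huv'
  have hx' : x = (n : ℂ)⁻¹ * (d * ψ'.1 ![0, 1]) := by
    rw [e1]
    field_simp
    linear_combination -hrs + ψ.1 ![1, 0] * hr' + ψ.1 ![0, 1] * hs'
  refine ⟨ψ', Ln.ext hψ' ?_⟩
  ext z
  rw [hL', ← hψ']
  refine mem_lattice_gammaN.trans ?_
  constructor
  · rintro ⟨a, b, rfl⟩
    refine ⟨b * e, LQ.mem_lattice.2 ⟨a, b * f, ?_⟩⟩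
    rw [hx']
    push_cast
    field_simp
    linear_combination b * ψ'.1 ![0, 1] * hef'
  · rintro ⟨k, hk⟩
    obtain ⟨a, b, hab⟩ := LQ.mem_lattice.1 hk
    refine ⟨a, b * n + k * d, ?_⟩
    have hz : z = a * ψ'.1 ![1, 0] + b * ψ'.1 ![0, 1] + k * x := by linear_combination -hab
    rw [hz, hx']
    push_cast
    field_simp
    ring

/-- The action of `B(Γ₀(n))` on `𝓛_n`: the one for which `π_n` is equivariant, see `smul_pi`. -/
instance : SMul (BGamma0 n) (Ln n) where
  smul γ p := pi n (γ.1 • Function.surjInv pi_surjective p)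

theorem smul_pi (γ : BGamma0 n) (ψ : LQ) : γ • pi n ψ = pi n (γ.1 • ψ) := by
  obtain ⟨g, hg, h⟩ := exists_of_pi_eq (Function.surjInv_eq pi_surjective (pi n ψ))
  have h2 : γ.1 * g * γ.1⁻¹ ∈ Gamma0Q n := (Subgroup.mem_normalizer_iff.1 γ.2 g).1 hg
  change pi n (γ.1 • Function.surjInv pi_surjective (pi n ψ)) = _
  generalize Function.surjInv pi_surjective (pi n ψ) = ψ' at h ⊢
  rw [← pi_smul_of_mem h2, ← h, smul_smul, smul_smul]
  congr 2
  group

instance : MulAction (BGamma0 n) (Ln n) where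
  one_smul p := by
    obtain ⟨ψ, rfl⟩ := pi_surjective p
    rw [smul_pi, OneMemClass.coe_one, one_smul]
  mul_smul γ γ' p := by
    obtain ⟨ψ, rfl⟩ := pi_surjective p
    rw [smul_pi, smul_pi, smul_pi, Subgroup.coe_mul, mul_smul]

end Ln

namespace Ln

variable {n : ℕ} (p : Ln n)

instance : DiscreteTopology p.L := p.isLattice.discrete

instance : CompactSpace (ℂ ⧸ p.L) := by
  have : DiscreteTopology (AddSubgroup.toIntSubmodule p.L) := p.isLattice.discrete
  have : IsZLattice ℝ (AddSubgroup.toIntSubmodule p.L) := ⟨p.isLattice.span_top⟩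
  have h := IsZLattice.isCompact_range_of_periodic (AddSubgroup.toIntSubmodule p.L)
    (QuotientAddGroup.mk : ℂ → ℂ ⧸ p.L) (Torus.isLocalHomeomorph_mk p.L).continuous
    (fun z w hw => by
      rw [QuotientAddGroup.eq_iff_sub_mem]
      simpa using! hw)
  rw [Set.range_eq_univ.2 QuotientAddGroup.mk_surjective] at h
  exact isCompact_univ_iff.1 h

instance : ConnectedSpace (ℂ ⧸ p.L) :=
  QuotientAddGroup.mk_surjective.connectedSpace (Torus.isLocalHomeomorph_mk p.L).continuous

end Ln

/-- Triples `(E, C, ω)`: an elliptic curve over `ℂ` in analytic form, that is a compact connected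
complex Lie group `E` of dimension one, a cyclic subgroup `C` of order `n`, and a nowhere vanishing
holomorphic differential on `E`. -/
structure Triple (n : ℕ) where
  E : Type
  [addCommGroup : AddCommGroup E]
  [topologicalSpace : TopologicalSpace E]
  [chartedSpace : ChartedSpace ℂ E]
  [lieAddGroup : LieAddGroup 𝓘(ℂ, ℂ) ω E]
  [t2Space : T2Space E]
  [compactSpace : CompactSpace E]
  [connectedSpace : ConnectedSpace E]
  C : AddSubgroup E
  cyclic : IsAddCyclic C
  card : Nat.card C = n
  form : ∀ x : E, TangentSpace 𝓘(ℂ, ℂ) x →L[ℂ] ℂ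
  holomorphic : ContMDiff 𝓘(ℂ, ℂ).tangent 𝓘(ℂ, ℂ) ω
    (fun v : TangentBundle 𝓘(ℂ, ℂ) E => form v.1 v.2)
  form_ne_zero : ∀ x, form x ≠ 0

attribute [instance] Triple.addCommGroup Triple.topologicalSpace Triple.chartedSpace
  Triple.lieAddGroup Triple.t2Space Triple.compactSpace Triple.connectedSpace

namespace Triple

variable {n : ℕ}

/-- A holomorphic homomorphism. -/
def IsHol (X Y : Triple n) (f : X.E →+ Y.E) : Prop := ContMDiff 𝓘(ℂ, ℂ) 𝓘(ℂ, ℂ) ω f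

/-- `f^* ω_Y = ω_X`. -/
def PullsBack (X Y : Triple n) (f : X.E →+ Y.E) : Prop :=
  ∀ (x : X.E) (v : TangentSpace 𝓘(ℂ, ℂ) x),
    Y.form (f x) (mfderiv 𝓘(ℂ, ℂ) 𝓘(ℂ, ℂ) f x v) = X.form x v

theorem IsHol.mdifferentiableAt {X Y : Triple n} {f : X.E →+ Y.E} (hf : IsHol X Y f) (x : X.E) :
    MDifferentiableAt 𝓘(ℂ, ℂ) 𝓘(ℂ, ℂ) f x := (hf x).mdifferentiableAt (by simp)

theorem IsHol.comp {X Y Z : Triple n} {f : X.E →+ Y.E} {g : Y.E →+ Z.E}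
    (hf : IsHol X Y f) (hg : IsHol Y Z g) : IsHol X Z (g.comp f) :=
  ContMDiff.comp (I' := 𝓘(ℂ, ℂ)) (g := g) (f := f) hg hf

theorem PullsBack.comp {X Y Z : Triple n} {f : X.E →+ Y.E} {g : Y.E →+ Z.E}
    (hf : IsHol X Y f) (hg : IsHol Y Z g) (h : PullsBack X Y f) (h' : PullsBack Y Z g) :
    PullsBack X Z (g.comp f) := by
  intro x v
  rw [← h x v, ← h' (f x)]
  have e := mfderiv_comp x (hg.mdifferentiableAt (f x)) (hf.mdifferentiableAt x)
  rw [AddMonoidHom.coe_comp, e]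
  rfl

theorem PullsBack.id (X : Triple n) : PullsBack X X (AddMonoidHom.id X.E) := by
  intro x v
  have e : mfderiv 𝓘(ℂ, ℂ) 𝓘(ℂ, ℂ) (AddMonoidHom.id X.E) x = ContinuousLinearMap.id ℂ _ :=
    mfderiv_id
  rw [e]
  rfl

theorem PullsBack.symm {X Y : Triple n} {f : X.E ≃+ Y.E}
    (hf : IsHol X Y f) (hg : IsHol Y X f.symm) (h : PullsBack X Y f) : PullsBack Y X f.symm := by
  intro y v
  have e := mfderiv_comp (I := 𝓘(ℂ, ℂ)) (I' := 𝓘(ℂ, ℂ)) (I'' := 𝓘(ℂ, ℂ)) y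
    (hf.mdifferentiableAt (f.symm y)) (hg.mdifferentiableAt y)
  have key : ∀ k : Y.E → Y.E, k = _root_.id →
      Y.form (k y) (mfderiv 𝓘(ℂ, ℂ) 𝓘(ℂ, ℂ) k y v) = Y.form y v := by
    rintro k rfl
    rw [mfderiv_id]
    rfl
  have h1 := key (f ∘ f.symm) (funext fun z => f.apply_symm_apply z)
  rw [show mfderiv 𝓘(ℂ, ℂ) 𝓘(ℂ, ℂ) (f ∘ f.symm) y = _ from e] at h1
  rw [← h1]
  exact (h (f.symm y) _).symm

/-- Isomorphism of pairs `(E, C)`. -/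
def PairIso (X Y : Triple n) : Prop :=
  ∃ f : X.E ≃+ Y.E, IsHol X Y f ∧ IsHol Y X f.symm ∧ X.C.map (f : X.E →+ Y.E) = Y.C

/-- Isomorphism of triples `(E, C, ω)`. -/
def Iso (X Y : Triple n) : Prop :=
  ∃ f : X.E ≃+ Y.E, IsHol X Y f ∧ IsHol Y X f.symm ∧ X.C.map (f : X.E →+ Y.E) = Y.C ∧
    PullsBack X Y f

theorem isHol_id (X : Triple n) : IsHol X X (AddEquiv.refl X.E) := contMDiff_id

theorem map_symm {X Y : Triple n} {f : X.E ≃+ Y.E} (h : X.C.map (f : X.E →+ Y.E) = Y.C) :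
    Y.C.map (f.symm : Y.E →+ X.E) = X.C := by
  rw [← h, AddSubgroup.map_map]
  convert AddSubgroup.map_id X.C
  ext x
  simp

theorem map_trans {X Y Z : Triple n} {f : X.E ≃+ Y.E} {g : Y.E ≃+ Z.E}
    (h : X.C.map (f : X.E →+ Y.E) = Y.C) (h' : Y.C.map (g : Y.E →+ Z.E) = Z.C) :
    X.C.map ((f.trans g : X.E ≃+ Z.E) : X.E →+ Z.E) = Z.C := by
  rw [← h', ← h, AddSubgroup.map_map]
  rfl

theorem pairIso_equivalence : Equivalence (PairIso (n := n)) where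
  refl X := ⟨AddEquiv.refl _, isHol_id X, isHol_id X, AddSubgroup.map_id X.C⟩
  symm := fun ⟨f, hf, hg, h⟩ => ⟨f.symm, hg, hf, map_symm h⟩
  trans := fun ⟨f, hf, hf', h⟩ ⟨g, hg, hg', h'⟩ =>
    ⟨f.trans g, IsHol.comp hf hg, IsHol.comp hg' hf', map_trans h h'⟩

theorem iso_equivalence : Equivalence (Iso (n := n)) where
  refl X := ⟨AddEquiv.refl _, isHol_id X, isHol_id X, AddSubgroup.map_id X.C, PullsBack.id X⟩
  symm := fun ⟨f, hf, hg, h, hp⟩ => ⟨f.symm, hg, hf, map_symm h, hp.symm hf hg⟩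
  trans := fun ⟨f, hf, hf', h, hp⟩ ⟨g, hg, hg', h', hp'⟩ =>
    ⟨f.trans g, IsHol.comp hf hg, IsHol.comp hg' hf', map_trans h h',
      hp.comp hf hg hp'⟩

/-- The triple `(E, C, a⁻¹ ω)`, the image of `(E, C, ω)` under the scalar matrix `a`. -/
def scale (X : Triple n) (a : ℚ) (ha : a ≠ 0) : Triple n where
  E := X.E
  C := X.C
  cyclic := X.cyclic
  card := X.card
  form := fun x => (a : ℂ)⁻¹ • X.form x
  holomorphic := by
    have h : ContMDiff 𝓘(ℂ, ℂ).tangent 𝓘(ℂ, ℂ) ω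
      (fun v : TangentBundle 𝓘(ℂ, ℂ) X.E => (a : ℂ)⁻¹ * X.form v.1 v.2) :=
      contMDiff_const.mul X.holomorphic
    exact h
  form_ne_zero := fun x => smul_ne_zero (by simpa using ha) (X.form_ne_zero x)

end Triple

/-- The set `𝓒_n^an` of isomorphism classes of triples `(E, C, ω)`. -/
def Can (n : ℕ) : Type 1 := Quotient (⟨Triple.Iso, Triple.iso_equivalence⟩ : Setoid (Triple n))

/-- The set of isomorphism classes of pairs `(E, C)`. -/
def PairCan (n : ℕ) : Type 1 :=
  Quotient (⟨Triple.PairIso, Triple.pairIso_equivalence⟩ : Setoid (Triple n))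

/-- The isomorphism class of a triple. -/
def Triple.toCan {n : ℕ} (X : Triple n) : Can n := Quotient.mk _ X

/-- The map `[(E, C, ω)] ↦ [(E, C)]`. -/
def Can.forget {n : ℕ} : Can n → PairCan n :=
  Quotient.map' _root_.id fun _ _ ⟨f, hf, hg, h, _⟩ => ⟨f, hf, hg, h⟩

/-- The triple `(ℂ/L, L'/L, 2πi dz)`. -/
def Ln.toTriple {n : ℕ} (p : Ln n) : Triple n where
  E := ℂ ⧸ p.L
  C := p.L'.map (QuotientAddGroup.mk' p.L)
  cyclic := p.cyclic
  card := p.card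
  form := Torus.form (2 * Real.pi * Complex.I)
  holomorphic := Torus.contMDiff_form _
  form_ne_zero := fun x h => by
    have h1 := congrArg (fun l : ℂ →L[ℂ] ℂ => l 1) h
    have h2 : (2 * Real.pi * Complex.I : ℂ) * 1 = 0 := h1
    simp [Real.pi_ne_zero] at h2

/-- The map `F_n : 𝓛_n → 𝓒_n^an`. -/
def F (n : ℕ) (p : Ln n) : Can n := p.toTriple.toCan

/-- The choices made in the construction of `γ(E, C, ω)`: a factorization `γ = a g` with
`a ∈ ℚˣ` and `g` an integral matrix of determinant `δ > 0`, and an isomorphism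
`φ : (ℤ/nδℤ)² ≅ E[nδ]` such that `φ(0, δ)` generates `C`. -/
structure Choice {n : ℕ} (γ : GL(2, ℚ)⁺) (X : Triple n) where
  a : ℚ
  a_ne_zero : a ≠ 0
  g : Matrix (Fin 2) (Fin 2) ℤ
  δ : ℕ
  δ_pos : 0 < δ
  det_eq : g.det = δ
  eq_smul : (γ.1 : Matrix (Fin 2) (Fin 2) ℚ) = a • g.map (Int.cast : ℤ → ℚ)
  φ : (Fin 2 → ZMod (n * δ)) →+ X.E
  injective : Function.Injective φ
  mem_range : ∀ P : X.E, P ∈ φ.range ↔ (n * δ) • P = 0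
  C_eq : AddSubgroup.zmultiples (φ ![0, (δ : ZMod (n * δ))]) = X.C

namespace Choice

variable {n : ℕ} {γ : GL(2, ℚ)⁺} {X : Triple n} (c : Choice γ X)

/-- The value of `φ` at the `i`-th row of the integral matrix `g`. -/
def row (i : Fin 2) : X.E := c.φ fun j => (c.g i j : ZMod (n * c.δ))

/-- The subgroup `C_γ = n⟨φ(a,b), φ(c,d)⟩` where `(a,b)` and `(c,d)` are the rows of `g`. -/
def Cγ : AddSubgroup X.E := (AddSubgroup.closure {c.row 0, c.row 1}).map (nsmulAddMonoidHom n)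

/-- `q : E → E'` exhibits `E'` as the quotient `E/C_γ`, the subgroup of `X'` is
`C' = (⟨φ(c,d)⟩ + C_γ)/C_γ`, and the differential of `X'` pulls back to `ω`. -/
def IsQuotient (X' : Triple n) (q : X.E →+ X'.E) : Prop :=
  Triple.IsHol X X' q ∧ Function.Surjective q ∧ q.ker = c.Cγ ∧
    X'.C = (AddSubgroup.zmultiples (c.row 1) ⊔ c.Cγ).map q ∧ Triple.PullsBack X X' q

/-- `y` is the class of the triple `γ(E, C, ω)` obtained from the given choices: the scalar `a`
applied to the quotient triple `(E/C_γ, C', ω')`. -/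
def Yields (y : Can n) : Prop :=
  ∃ (X' : Triple n) (q : X.E →+ X'.E), c.IsQuotient X' q ∧ y = (X'.scale c.a c.a_ne_zero).toCan

/-- `φ` is oriented: it comes from an oriented basis of the period lattice of `E`, that is
`φ(x, y) = u(ψ(x/nδ, y/nδ))` for a uniformization `u : ℂ → E` with kernel `L_ψ`, `ψ ∈ LQ`. -/
def IsOriented : Prop :=
  ∃ (ψ : LQ) (u : ℂ →+ X.E), ContMDiff 𝓘(ℂ, ℂ) 𝓘(ℂ, ℂ) ω u ∧ Function.Surjective u ∧
    u.ker = ψ.lattice ∧ ∀ x y : ℤ, c.φ ![(x : ZMod (n * c.δ)), (y : ZMod (n * c.δ))] =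
      u (ψ.hom ![(x : ℚ) / (n * c.δ : ℕ), (y : ℚ) / (n * c.δ : ℕ)])

end Choice

/-- The set of all values of `γ x`, for all representatives of the class `x` and all choices with
`φ` oriented. -/
def moduliAction {n : ℕ} (γ : GL(2, ℚ)⁺) (x : Can n) : Set (Can n) :=
  {y | ∃ (X : Triple n) (c : Choice γ X), X.toCan = x ∧ c.IsOriented ∧ c.Yields y}

/-- The set of all values of `γ x`, for all representatives of the class `x` and all choices,
with no condition on the orientation of `φ`. -/
def unorientedAction {n : ℕ} (γ : GL(2, ℚ)⁺) (x : Can n) : Set (Can n) :=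
  {y | ∃ (X : Triple n) (c : Choice γ X), X.toCan = x ∧ c.Yields y}

/-- The set of all values of `γ` at a class of pairs `(E, C)`: add a differential, apply `γ`, and
forget the differential. -/
def pairAction {n : ℕ} (γ : GL(2, ℚ)⁺) (x : PairCan n) : Set (PairCan n) :=
  {y | ∃ x' y' : Can n, x'.forget = x ∧ y'.forget = y ∧ y' ∈ moduliAction γ x'}

/-- `γ M γ⁻¹ ⊆ M`, where `M` is the set of integral matrices with lower left entry divisible by `n`
and determinant prime to `n`. -/
def PreservesLevel (n : ℕ) (γ : GL(2, ℚ)⁺) : Prop :=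
  ∀ h : Matrix (Fin 2) (Fin 2) ℤ, (n : ℤ) ∣ h 1 0 → IsCoprime h.det (n : ℤ) →
    ∃ h' : Matrix (Fin 2) (Fin 2) ℤ, (n : ℤ) ∣ h' 1 0 ∧
      (γ.1 : Matrix (Fin 2) (Fin 2) ℚ) * h.map (Int.cast : ℤ → ℚ) =
        h'.map (Int.cast : ℤ → ℚ) * (γ.1 : Matrix (Fin 2) (Fin 2) ℚ)

/-- The action of `GL₂(ℚ)⁺` on the upper half-plane by Möbius transformations. -/
def moebius (γ : GL(2, ℚ)⁺) (τ : ℍ) : ℍ :=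
  Matrix.GeneralLinearGroup.map (algebraMap ℚ ℝ) γ.1 • τ

/-- The analytic modular curve `Γ₀(n)\ℍ`. -/
abbrev Y0 (n : ℕ) : Type := MulAction.orbitRel.Quotient (CongruenceSubgroup.Gamma0 n) ℍ

namespace Y0

variable {n : ℕ}

/-- The class of `τ` in `Γ₀(n)\ℍ`. -/
def mk (n : ℕ) (τ : ℍ) : Y0 n := Quotient.mk _ τ

theorem moebius_mul (γ γ' : GL(2, ℚ)⁺) (τ : ℍ) :
    moebius (γ * γ') τ = moebius γ (moebius γ' τ) := by
  simp [moebius, mul_smul]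

theorem mk_eq_iff {τ τ' : ℍ} : mk n τ = mk n τ' ↔ ∃ g ∈ Gamma0Q n, moebius g τ' = τ := by
  refine Quotient.eq.trans ?_
  constructor
  · rintro ⟨g, rfl⟩
    exact ⟨_, ⟨g.1, g.2, rfl⟩, rfl⟩
  · rintro ⟨_, ⟨g, hg, rfl⟩, rfl⟩
    exact ⟨⟨g, hg⟩, rfl⟩

/-- `B(Γ₀(n))` acts on `Γ₀(n)\ℍ` through Möbius transformations. -/
instance : MulAction (BGamma0 n) (Y0 n) where
  smul γ := Quotient.lift (fun τ => mk n (moebius γ.1 τ)) fun τ τ' h => by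
    obtain ⟨g, hg, rfl⟩ := mk_eq_iff.1 (show mk n τ = mk n τ' from Quotient.sound h)
    refine mk_eq_iff.2 ⟨γ.1 * g * γ.1⁻¹, (Subgroup.mem_normalizer_iff.1 γ.2 g).1 hg, ?_⟩
    rw [← moebius_mul, ← moebius_mul]
    congr 1
    group
  one_smul := by
    rintro ⟨τ⟩
    exact congrArg (mk n) (by simp [moebius])
  mul_smul γ γ' := by
    rintro ⟨τ⟩
    exact congrArg (mk n) (moebius_mul _ _ _)

theorem smul_mk (γ : BGamma0 n) (τ : ℍ) : γ • mk n τ = mk n (moebius γ.1 τ) := rfl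

end Y0

/-- The map `LQ → ℍ`, `ψ ↦ ψ(1,0)/ψ(0,1)`. -/
def LQ.tau (ψ : LQ) : ℍ := ⟨ψ.hom ![1, 0] / ψ.hom ![0, 1], ψ.pos⟩

end

/-!
The proof transports the construction to `ℂ`.  Call a surjective holomorphic homomorphism
`u : ℂ → E` with kernel `L_ψ` such that `u(ψ(0, 1/n))` generates `C` a uniformization of `(E, C)` by
`ψ`, and call it normalized if `u^* ω = 2πi dz`.

For any uniformization, `u^* ω = h dz` with `h` entire and periodic under `L_ψ`, so that `h` is
constant by Liouville's theorem; it is not zero, since otherwise `u` would be locally constant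
(`Triple.IsUniformization.exists_pullbackCoeff_eq`).  Hence `u` becomes normalized after replacing
`ψ` by a multiple `bψ`.  A triple with a normalized uniformization by `ψ` is isomorphic to
`(ℂ/L_ψ, L_{γ_n ψ}/L_ψ, 2πi dz)`, so its class is `F_n(π_n(ψ))`
(`Triple.IsUniformization.toCan_eq`), and `F_n` is injective (`F_injective`), because a homomorphism
`ℂ → ℂ/L` along which `dz` pulls back to `dz` has to be the projection.

If `φ` comes from a normalized uniformization `u` by `ψ` and `γ = a g`, then `C_γ` is the image of
`L_{gψ}`, and `z ↦ q(u(az))`, with `q : E → E'` the quotient map, is a normalized uniformization of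
`(E', C', a⁻¹ω')` by `γψ` (`Choice.IsQuotient.isUniformization`).  So the value is
`F_n(π_n(γψ)) = F_n(γ π_n(ψ))`.  Together with the injectivity of `F_n` this gives the independence of
all choices for oriented `φ`; that the construction can be carried out is seen on complex tori.

An arbitrary `φ` differs from an oriented one by right multiplication by an integral matrix `h` of
determinant prime to `n` with lower left entry divisible by `n`.  If `γ M γ⁻¹ ⊆ M`, then `g h = k g`
with `k` integral and its lower left entry divisible by `n`; therefore `C_γ` and `⟨φ(r, s)⟩ + C_γ`
for `φ` are contained in those for the oriented isomorphism, and by symmetry they are equal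
(`Choice.isQuotient_of_preservesLevel`).

For pairs without differential, `F_n(π_n(ψ))` and `F_n(π_n(ψ'))` have the same underlying class if and
only if `ψ'` lies in the `Γ₀(n)`-orbit of a multiple of `ψ`, that is, if the corresponding points of
the upper half-plane are equivalent under `Γ₀(n)` (`forget_F_eq_iff`).
-/

noncomputable section

/-! ### Pull-backs of differentials to `ℂ` -/

namespace Triple

variable {n : ℕ}

/-- The function `h : ℂ → ℂ` such that `k^* ω_X = h dz`. -/
def pullbackCoeff (X : Triple n) (k : ℂ → X.E) (z : ℂ) : ℂ :=
  X.form (k z) (mfderiv 𝓘(ℂ, ℂ) 𝓘(ℂ, ℂ) k z (1 : ℂ))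

theorem pullbackCoeff_comp_right {X : Triple n} {k : ℂ → X.E} (hk : ContMDiff 𝓘(ℂ, ℂ) 𝓘(ℂ, ℂ) ω k)
    {g : ℂ → ℂ} {g' z : ℂ} (hg : HasDerivAt g g' z) :
    X.pullbackCoeff (k ∘ g) z = g' * X.pullbackCoeff k (g z) := by
  have hk' : MDifferentiableAt 𝓘(ℂ, ℂ) 𝓘(ℂ, ℂ) k (g z) := (hk (g z)).mdifferentiableAt (by simp)
  have e := mfderiv_comp z hk' hg.differentiableAt.mdifferentiableAt
  have e2 : mfderiv 𝓘(ℂ, ℂ) 𝓘(ℂ, ℂ) g z (1 : ℂ) = g' • (1 : ℂ) := by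
    rw [mfderiv_eq_fderiv, hg.hasFDerivAt.fderiv]
    change (1 : ℂ) • g' = g' • (1 : ℂ)
    simp
  unfold pullbackCoeff
  rw [e]
  change X.form (k (g z)) (mfderiv 𝓘(ℂ, ℂ) 𝓘(ℂ, ℂ) k (g z)
    (mfderiv 𝓘(ℂ, ℂ) 𝓘(ℂ, ℂ) g z (1 : ℂ))) = _
  rw [e2]
  exact ((X.form (k (g z))).comp (mfderiv 𝓘(ℂ, ℂ) 𝓘(ℂ, ℂ) k (g z))).map_smul g' (1 : ℂ)

theorem PullsBack.pullbackCoeff {X Y : Triple n} {f : X.E →+ Y.E} (h : PullsBack X Y f)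
    (hf : IsHol X Y f) {k : ℂ → X.E} (hk : ContMDiff 𝓘(ℂ, ℂ) 𝓘(ℂ, ℂ) ω k) (z : ℂ) :
    Y.pullbackCoeff (f ∘ k) z = X.pullbackCoeff k z := by
  have e := mfderiv_comp z (hf.mdifferentiableAt (k z)) ((hk z).mdifferentiableAt (by simp))
  unfold Triple.pullbackCoeff
  rw [e]
  exact h (k z) _

theorem contDiff_pullbackCoeff {X : Triple n} {k : ℂ → X.E}
    (hk : ContMDiff 𝓘(ℂ, ℂ) 𝓘(ℂ, ℂ) ω k) : ContDiff ℂ ω (X.pullbackCoeff k) := by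
  have h1 : ContMDiff 𝓘(ℂ, ℂ).tangent 𝓘(ℂ, ℂ).tangent ω (tangentMap 𝓘(ℂ, ℂ) 𝓘(ℂ, ℂ) k) :=
    hk.contMDiff_tangentMap (by simp)
  have h2 : ContMDiff 𝓘(ℂ, ℂ) 𝓘(ℂ, ℂ).tangent ω
      (fun z : ℂ => (⟨z, (1 : ℂ)⟩ : TangentBundle 𝓘(ℂ, ℂ) ℂ)) := by
    intro z
    rw [Bundle.contMDiffAt_totalSpace]
    refine ⟨contMDiffAt_id, ?_⟩
    have e : (fun z' : ℂ => (trivializationAt ℂ (TangentSpace 𝓘(ℂ, ℂ)) z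
        (⟨z', (1 : ℂ)⟩ : TangentBundle 𝓘(ℂ, ℂ) ℂ)).2) = fun _ => (1 : ℂ) := by
      funext z'
      rw [trivializationAt_model_space_apply]
    exact e ▸ contMDiffAt_const
  rw [← contMDiff_iff_contDiff]
  have h3 := ContMDiff.comp (I' := 𝓘(ℂ, ℂ).tangent) h1 h2
  exact ContMDiff.comp (I' := 𝓘(ℂ, ℂ).tangent) X.holomorphic h3

theorem eq_zero_of_form_eq_zero (X : Triple n) (x : X.E) {v : ℂ} (h : X.form x v = 0) : v = 0 := by
  have key : ∀ l : ℂ →L[ℂ] ℂ, l ≠ 0 → l v = 0 → v = 0 := by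
    intro l hl hlv
    by_contra hv
    refine hl (ContinuousLinearMap.ext fun w => ?_)
    rw [← div_mul_cancel₀ w hv, ← smul_eq_mul, map_smul, hlv, smul_zero]
    rfl
  exact key _ (X.form_ne_zero x) h

/-- Two homomorphisms from `ℂ` that agree near zero agree, because `ℂ` is divisible. -/
theorem hom_eq_of_eventuallyEq {A : Type*} [AddCommGroup A] {u v : ℂ →+ A}
    (h : ∀ᶠ z in nhds (0 : ℂ), u z = v z) : u = v := by
  ext z
  have h1 : Filter.Tendsto (fun m : ℕ => z * ((m : ℂ) + 1)⁻¹) Filter.atTop (nhds 0) := by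
    have := (tendsto_one_div_add_atTop_nhds_zero_nat (𝕜 := ℂ)).const_mul z
    simpa using this
  obtain ⟨m, hm⟩ := (h1.eventually h).exists
  have h2 : z = (m + 1) • (z * ((m : ℂ) + 1)⁻¹) := by
    have : (m : ℂ) + 1 ≠ 0 := Nat.cast_add_one_ne_zero m
    rw [nsmul_eq_mul]
    push_cast
    field_simp
  rw [h2, map_nsmul, map_nsmul, hm]

end Triple

/-! ### Holomorphic homomorphisms of elliptic curves -/

namespace Triple

variable {n : ℕ}

/-- A holomorphic homomorphism from `ℂ` along which `ω` pulls back to zero is locally constant, hence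
zero. -/
theorem hom_eq_zero_of_pullbackCoeff_eq_zero {X : Triple n} {u : ℂ →+ X.E}
    (hu : ContMDiff 𝓘(ℂ, ℂ) 𝓘(ℂ, ℂ) ω u) (h : ∀ z, X.pullbackCoeff u z = 0) : u = 0 := by
  refine hom_eq_of_eventuallyEq ?_
  set e := chartAt ℂ (u 0)
  have hV : u ⁻¹' e.source ∈ nhds (0 : ℂ) :=
    hu.continuous.continuousAt.preimage_mem_nhds (e.open_source.mem_nhds (mem_chart_source ℂ _))
  obtain ⟨r, hr, hrV⟩ := Metric.mem_nhds_iff.1 hV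
  have hd : ∀ z, u z ∈ e.source → HasFDerivAt (𝕜 := ℂ) (e ∘ u) (0 : ℂ →L[ℂ] ℂ) z := by
    intro z hz
    have h1 : MDifferentiableAt 𝓘(ℂ, ℂ) 𝓘(ℂ, ℂ) e (u z) :=
      ((contMDiffOn_chart (I := 𝓘(ℂ, ℂ)) (n := ω) (x := u 0)).contMDiffAt
        (e.open_source.mem_nhds hz)).mdifferentiableAt (by simp)
    have h2 : MDifferentiableAt 𝓘(ℂ, ℂ) 𝓘(ℂ, ℂ) u z := (hu z).mdifferentiableAt (by simp)
    have h3 : mfderiv 𝓘(ℂ, ℂ) 𝓘(ℂ, ℂ) u z = (0 : ℂ →L[ℂ] ℂ) :=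
      ContinuousLinearMap.ext_ring (X.eq_zero_of_form_eq_zero (u z) (h z))
    have h4 := mfderiv_comp z h1 h2
    have h5 : DifferentiableAt ℂ (e ∘ u) z :=
      mdifferentiableAt_iff_differentiableAt.1 (MDifferentiableAt.comp z h1 h2)
    rw [mfderiv_eq_fderiv, h3] at h4
    have h6 := h5.hasFDerivAt
    rw [h4] at h6
    exact h6.congr_fderiv (ContinuousLinearMap.ext fun _ =>
      map_zero (mfderiv 𝓘(ℂ, ℂ) 𝓘(ℂ, ℂ) e (u z)))
  -- A function with zero derivative on a ball is constant there.
  have hc : ∀ z ∈ Metric.ball (0 : ℂ) r, (e ∘ u) z = (e ∘ u) 0 := fun z hz =>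
    (convex_ball (0 : ℂ) r).is_const_of_fderivWithin_eq_zero (𝕜 := ℂ)
      (fun w hw => (hd w (hrV hw)).differentiableAt.differentiableWithinAt)
      (fun w hw => by
        rw [fderivWithin_of_isOpen Metric.isOpen_ball hw, (hd w (hrV hw)).fderiv])
      hz (Metric.mem_ball_self hr)
  filter_upwards [Metric.ball_mem_nhds (0 : ℂ) hr] with z hz
  have := e.injOn (hrV hz) (hrV (Metric.mem_ball_self hr)) (hc z hz)
  simpa using this

/-- A bijective holomorphic homomorphism of elliptic curves along which the nowhere vanishing
differentials correspond has nonzero derivative in charts, so its inverse is holomorphic. -/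
theorem IsHol.symm {X Y : Triple n} {f : X.E ≃+ Y.E} (hf : IsHol X Y f) (h : PullsBack X Y f) :
    IsHol Y X f.symm := by
  intro y
  obtain ⟨x, rfl⟩ := f.surjective y
  have hfc : Continuous (f : X.E → Y.E) := hf.continuous
  -- The inverse is continuous because `X.E` is compact and `Y.E` is Hausdorff.
  let H : X.E ≃ₜ Y.E := Continuous.homeoOfEquivCompactToT2 (f := f.toEquiv) hfc
  let e := chartAt ℂ x
  let e' := chartAt ℂ (f x)
  let G : OpenPartialHomeomorph ℂ ℂ := e.symm.trans (H.toOpenPartialHomeomorph.trans e')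
  have hG : (G : ℂ → ℂ) = e' ∘ f ∘ e.symm := rfl
  have hG' : (G.symm : ℂ → ℂ) = e ∘ f.symm ∘ e'.symm := rfl
  have hGx : G.symm (e' (f x)) = e x := by
    rw [hG']
    simp only [Function.comp_apply]
    rw [e'.left_inv (mem_chart_source ℂ (f x)), f.symm_apply_apply]
  have hxG : e x ∈ G.source := by
    change e x ∈ (e.symm.trans (H.toOpenPartialHomeomorph.trans e')).source
    rw [OpenPartialHomeomorph.trans_source, OpenPartialHomeomorph.symm_source]
    refine ⟨e.map_source (mem_chart_source ℂ x), ?_⟩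
    rw [Set.mem_preimage, e.left_inv (mem_chart_source ℂ x)]
    rw [OpenPartialHomeomorph.trans_source]
    exact ⟨Set.mem_univ _, mem_chart_source ℂ (f x)⟩
  have hyG : e' (f x) ∈ G.target := by
    have := G.map_source hxG
    rwa [hG, Function.comp_apply, Function.comp_apply, e.left_inv (mem_chart_source ℂ x)] at this
  have hcd : ContDiffAt ℂ ω G (e x) := by
    have := (contMDiffAt_iff.1 (hf x)).2
    simpa [hG, e, e'] using! this
  have hder : mfderiv 𝓘(ℂ, ℂ) 𝓘(ℂ, ℂ) f x = fderiv ℂ G (e x) := by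
    have := (hf.mdifferentiableAt x).mfderiv
    rw [modelWithCornersSelf_coe, Set.range_id, fderivWithin_univ] at this
    exact this
  -- If the derivative vanished at `x`, so would `f^* ω_Y = ω_X`.
  have hne : deriv G (e x) ≠ 0 := by
    intro h0
    have h1 : fderiv ℂ G (e x) = 0 := ContinuousLinearMap.ext_ring (by simpa using h0)
    refine X.form_ne_zero x (ContinuousLinearMap.ext fun v => ?_)
    have h2 := h x v
    change Y.form (f x) (mfderiv 𝓘(ℂ, ℂ) 𝓘(ℂ, ℂ) f x v) = _ at h2
    rw [hder, h1] at h2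
    rw [← h2]
    exact map_zero (Y.form (f x))
  have key : ContDiffAt ℂ ω G.symm (e' (f x)) := by
    refine G.contDiffAt_symm_deriv hne hyG ?_ ?_ <;> rw [hGx]
    · exact (hcd.differentiableAt (by simp)).hasDerivAt
    · exact hcd
  rw [contMDiffAt_iff]
  refine ⟨H.symm.continuous.continuousAt, ?_⟩
  have h1 : f.symm (f x) = x := f.symm_apply_apply x
  have h2 := key.contDiffWithinAt (s := Set.univ)
  rw [hG'] at h2
  change ContDiffWithinAt ℂ ω (extChartAt 𝓘(ℂ, ℂ) (f.symm (f x)) ∘ f.symm ∘ _) _ _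
  rw [h1]
  simpa [e, e'] using! h2

end Triple

/-- Holomorphy on `ℂ ⧸ L` can be tested on `ℂ`, since the charts are sections of the projection. -/
theorem Torus.contMDiff_of_comp_mk {L : AddSubgroup ℂ} [DiscreteTopology L] {M : Type*}
    [TopologicalSpace M] [ChartedSpace ℂ M] {f : ℂ ⧸ L → M}
    (h : ContMDiff 𝓘(ℂ, ℂ) 𝓘(ℂ, ℂ) ω (f ∘ (QuotientAddGroup.mk : ℂ → ℂ ⧸ L))) :
    ContMDiff 𝓘(ℂ, ℂ) 𝓘(ℂ, ℂ) ω f := by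
  intro q
  have h1 : ContMDiffAt 𝓘(ℂ, ℂ) 𝓘(ℂ, ℂ) ω (chartAt ℂ q) q :=
    (contMDiffOn_chart (I := 𝓘(ℂ, ℂ)) (x := q)).contMDiffAt
      ((chartAt ℂ q).open_source.mem_nhds (mem_chart_source ℂ q))
  refine (ContMDiffAt.comp q (h _) h1).congr_of_eventuallyEq ?_
  filter_upwards [(chartAt ℂ q).open_source.mem_nhds (mem_chart_source ℂ q)] with x hx
  simp only [Function.comp_apply]
  rw [mk_atlas (chart_mem_atlas ℂ q) hx]

namespace Ln

variable {n : ℕ}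

/-- The projection `ℂ → ℂ ⧸ L` as a homomorphism to the group of the triple. -/
def proj (p : Ln n) : ℂ →+ p.toTriple.E := QuotientAddGroup.mk' p.L

theorem contMDiff_proj (p : Ln n) : ContMDiff 𝓘(ℂ, ℂ) 𝓘(ℂ, ℂ) ω p.proj := Torus.contMDiff_mk

theorem proj_surjective (p : Ln n) : Function.Surjective p.proj := QuotientAddGroup.mk_surjective

theorem ker_proj (p : Ln n) : p.proj.ker = p.L := QuotientAddGroup.ker_mk' p.L

theorem pullbackCoeff_proj (p : Ln n) (z : ℂ) :
    p.toTriple.pullbackCoeff p.proj z = 2 * Real.pi * Complex.I :=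
  (Torus.form_comp_mfderiv_mk (L := p.L) _ z 1).trans (mul_one _)

/-- Since the projection `ℂ → ℂ ⧸ L` is a local isomorphism, pull-backs of differentials to `ℂ ⧸ L`
can be computed on `ℂ`. -/
theorem pullsBack_of_comp_proj {p : Ln n} {Y : Triple n} {f : p.toTriple.E →+ Y.E}
    (hf : Triple.IsHol p.toTriple Y f)
    (h : ∀ z, Y.pullbackCoeff (f ∘ p.proj) z = 2 * Real.pi * Complex.I) :
    Triple.PullsBack p.toTriple Y f := by
  intro x v
  obtain ⟨z, rfl⟩ := p.proj_surjective x
  have e := mfderiv_comp z (hf.mdifferentiableAt (p.proj z))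
    ((p.contMDiff_proj z).mdifferentiableAt (by simp))
  have e2 : mfderiv 𝓘(ℂ, ℂ) 𝓘(ℂ, ℂ) p.proj z = ContinuousLinearMap.id ℂ ℂ := Torus.mfderiv_mk z
  have h1 := h z
  unfold Triple.pullbackCoeff at h1
  rw [e, e2] at h1
  have key : ∀ l : ℂ →L[ℂ] ℂ, l (1 : ℂ) = 2 * Real.pi * Complex.I → ∀ w : ℂ,
      l w = 2 * Real.pi * Complex.I * w := by
    intro l hl w
    rw [← hl, ← mul_one w, ← smul_eq_mul w, map_smul]
    simp [mul_comm]
  exact key ((Y.form (f (p.proj z))).comp (mfderiv 𝓘(ℂ, ℂ) 𝓘(ℂ, ℂ) f (p.proj z))) h1 v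

end Ln

/-! ### Uniformizations -/

namespace LQ

/-- The homomorphism `c ψ` for `c ∈ ℂˣ`. -/
def homothety (c : ℂ) (hc : c ≠ 0) (ψ : LQ) : LQ :=
  ofPair (c * ψ.hom ![1, 0]) (c * ψ.hom ![0, 1]) (by
    rw [mul_div_mul_left _ _ hc]
    exact ψ.pos)

theorem homothety_hom (c : ℂ) (hc : c ≠ 0) (ψ : LQ) (v : Fin 2 → ℚ) :
    (homothety c hc ψ).hom v = c * ψ.hom v := by
  rw [apply, ψ.apply, homothety, ofPair_fst, ofPair_snd]
  ring

theorem mem_lattice_homothety {c : ℂ} {hc : c ≠ 0} {ψ : LQ} {z : ℂ} :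
    z ∈ (homothety c hc ψ).lattice ↔ c⁻¹ * z ∈ ψ.lattice := by
  simp only [mem_lattice, homothety_hom]
  refine exists₂_congr fun x y => ?_
  rw [eq_inv_mul_iff_mul_eq₀ hc]
  constructor <;> intro h <;> linear_combination h

theorem smul_homothety (γ : GL(2, ℚ)⁺) (c : ℂ) (hc : c ≠ 0) (ψ : LQ) :
    γ • homothety c hc ψ = homothety c hc (γ • ψ) := by
  apply LQ.ext <;> rw [homothety_hom, smul_apply, smul_apply, homothety_hom] <;> ring

theorem tau_homothety (c : ℂ) (hc : c ≠ 0) (ψ : LQ) : (homothety c hc ψ).tau = ψ.tau := by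
  apply UpperHalfPlane.ext
  change (homothety c hc ψ).hom ![1, 0] / (homothety c hc ψ).hom ![0, 1] = _
  rw [homothety_hom, homothety_hom, mul_div_mul_left _ _ hc]
  rfl

theorem exists_homothety_of_tau_eq {ψ ψ' : LQ} (h : ψ.tau = ψ'.tau) :
    ∃ (c : ℂ) (hc : c ≠ 0), ψ' = homothety c hc ψ := by
  have h1 : ψ.hom ![1, 0] / ψ.hom ![0, 1] = ψ'.hom ![1, 0] / ψ'.hom ![0, 1] :=
    congrArg UpperHalfPlane.coe h
  have h2 := ψ.snd_ne
  have h3 := ψ'.snd_ne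
  refine ⟨ψ'.hom ![0, 1] / ψ.hom ![0, 1], div_ne_zero h3 h2, LQ.ext ?_ ?_⟩ <;>
    rw [homothety_hom]
  · rw [div_mul_eq_mul_div, mul_div_assoc, h1]
    field_simp
  · field_simp

theorem tau_smul (γ : GL(2, ℚ)⁺) (ψ : LQ) : (γ • ψ).tau = moebius γ ψ.tau := by
  apply UpperHalfPlane.ext
  have hd := (det_pos γ).ne'
  have hd' : (((γ.1 : Matrix (Fin 2) (Fin 2) ℚ).det : ℚ) : ℂ)⁻¹ ≠ 0 := by simpa using hd
  have h2 := ψ.snd_ne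
  have hpos : 0 < (Matrix.GeneralLinearGroup.map (algebraMap ℚ ℝ) γ.1).det.val := by
    have := det_pos γ
    rw [Matrix.GeneralLinearGroup.val_det_apply, Matrix.GeneralLinearGroup.map]
    change 0 < ((algebraMap ℚ ℝ).mapMatrix (γ.1 : Matrix (Fin 2) (Fin 2) ℚ)).det
    rw [← RingHom.map_det]
    simpa using this
  rw [moebius, UpperHalfPlane.coe_smul_of_det_pos hpos]
  change (γ • ψ).hom ![1, 0] / (γ • ψ).hom ![0, 1] = _
  rw [smul_fst, smul_snd, mul_div_mul_left _ _ hd', UpperHalfPlane.num, UpperHalfPlane.denom]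
  change _ = ((algebraMap ℚ ℝ (γ.1.1 0 0) : ℝ) * (ψ.hom ![1, 0] / ψ.hom ![0, 1]) +
    (algebraMap ℚ ℝ (γ.1.1 0 1) : ℝ) : ℂ) / ((algebraMap ℚ ℝ (γ.1.1 1 0) : ℝ) *
    (ψ.hom ![1, 0] / ψ.hom ![0, 1]) + (algebraMap ℚ ℝ (γ.1.1 1 1) : ℝ))
  rw [← mul_div_mul_right (_ * (_ / _) + _) _ h2]
  simp only [eq_ratCast, Complex.ofReal_ratCast]
  congr 1 <;> field_simp

end LQ

namespace Triple

variable {n : ℕ}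

/-- `u : ℂ → E` is a holomorphic uniformization of the pair `(E, C)` with period lattice `L_ψ`, such
that `ψ(0, 1/n)` is mapped to a generator of `C`.  The differential of the triple is ignored. -/
structure IsUniformization (X : Triple n) (ψ : LQ) (u : ℂ →+ X.E) : Prop where
  contMDiff : ContMDiff 𝓘(ℂ, ℂ) 𝓘(ℂ, ℂ) ω u
  surjective : Function.Surjective u
  ker_eq : u.ker = ψ.lattice
  C_eq : X.C = AddSubgroup.zmultiples (u ((n : ℂ)⁻¹ * ψ.hom ![0, 1]))

/-- The differential of the triple pulls back to `2πi dz`. -/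
def IsNormalized (X : Triple n) (u : ℂ →+ X.E) : Prop :=
  ∀ z, X.pullbackCoeff u z = 2 * Real.pi * Complex.I

namespace IsUniformization

variable {X : Triple n} {ψ : LQ} {u : ℂ →+ X.E}

/-- The pull-back of the differential is invariant under `L_ψ`, hence bounded, hence constant by
Liouville's theorem. -/
theorem exists_pullbackCoeff_eq (hu : X.IsUniformization ψ u) :
    ∃ c : ℂ, c ≠ 0 ∧ ∀ z, X.pullbackCoeff u z = c := by
  have hper : ∀ z, ∀ l ∈ ψ.lattice, X.pullbackCoeff u (z + l) = X.pullbackCoeff u z := by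
    intro z l hl
    have h1 : u ∘ (fun w : ℂ => w + l) = u := by
      funext w
      rw [← hu.ker_eq, AddMonoidHom.mem_ker] at hl
      simp [hl]
    have h2 := pullbackCoeff_comp_right hu.contMDiff ((hasDerivAt_id z).add_const l)
    rw [one_mul] at h2
    change X.pullbackCoeff (u ∘ fun w : ℂ => w + l) z = X.pullbackCoeff u (z + l) at h2
    rw [← h2, h1]
  have hdiff : Differentiable ℂ (X.pullbackCoeff u) :=
    (contDiff_pullbackCoeff hu.contMDiff).differentiable (by simp)
  have : DiscreteTopology (AddSubgroup.toIntSubmodule ψ.lattice) := ψ.isLattice.discrete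
  have : IsZLattice ℝ (AddSubgroup.toIntSubmodule ψ.lattice) := ⟨ψ.isLattice.span_top⟩
  have hcpt := IsZLattice.isCompact_range_of_periodic (AddSubgroup.toIntSubmodule ψ.lattice)
    (X.pullbackCoeff u) hdiff.continuous hper
  have hconst := fun z => hdiff.apply_eq_apply_of_bounded hcpt.isBounded z 0
  refine ⟨X.pullbackCoeff u 0, fun h0 => ?_, hconst⟩
  -- If the constant is zero, then `u = 0`, but `ψ(0, 1/2)` is not in the kernel `L_ψ`.
  have h1 := hom_eq_zero_of_pullbackCoeff_eq_zero hu.contMDiff fun z => (hconst z).trans h0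
  have h2 : (2 : ℂ)⁻¹ * ψ.hom ![0, 1] ∈ ψ.lattice := by
    rw [← hu.ker_eq, h1]
    rfl
  obtain ⟨x, y, hxy⟩ := LQ.mem_lattice.1 h2
  have := ψ.int_ext (x := 2 * x) (y := 2 * y) (x' := 0) (y' := 1) (by
    push_cast
    linear_combination 2 * hxy)
  omega

/-- Every uniformization becomes normalized after a homothety of `ℂ`. -/
theorem exists_isNormalized (hu : X.IsUniformization ψ u) :
    ∃ (c : ℂ) (hc : c ≠ 0) (u' : ℂ →+ X.E), X.IsUniformization (LQ.homothety c hc ψ) u' ∧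
      X.IsNormalized u' ∧ ∀ z, u' (c * z) = u z := by
  obtain ⟨b, hb, hbu⟩ := hu.exists_pullbackCoeff_eq
  have hpi : (2 * Real.pi * Complex.I : ℂ) ≠ 0 := Complex.two_pi_I_ne_zero
  have hc : b / (2 * Real.pi * Complex.I : ℂ) ≠ 0 := div_ne_zero hb hpi
  -- Rescaling by `c = b / 2πi` turns `b dz` into `2πi dz`.
  generalize hcdef : b / (2 * Real.pi * Complex.I : ℂ) = c at hc
  have hfun : ∀ z, u.comp (AddMonoidHom.mulLeft c⁻¹) (c * z) = u z := fun z => by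
    simp [hc]
  refine ⟨c, hc, u.comp (AddMonoidHom.mulLeft c⁻¹), ⟨?_, ?_, ?_, ?_⟩, ?_, hfun⟩
  · have : ContMDiff 𝓘(ℂ, ℂ) 𝓘(ℂ, ℂ) ω (fun z : ℂ => c⁻¹ * z) :=
      contMDiff_iff_contDiff.2 (by fun_prop)
    exact hu.contMDiff.comp this
  · intro P
    obtain ⟨z, rfl⟩ := hu.surjective P
    exact ⟨c * z, hfun z⟩
  · ext z
    rw [LQ.mem_lattice_homothety, ← hu.ker_eq]
    rfl
  · rw [hu.C_eq, LQ.homothety_hom, mul_left_comm, hfun]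
  · intro z
    have h1 := pullbackCoeff_comp_right hu.contMDiff ((hasDerivAt_id z).const_mul c⁻¹)
    rw [hbu, mul_one] at h1
    refine h1.trans ?_
    rw [← hcdef]
    field_simp

theorem comp_equiv (hu : X.IsUniformization ψ u) {Y : Triple n} {f : X.E ≃+ Y.E}
    (hf : IsHol X Y f) (hC : X.C.map (f : X.E →+ Y.E) = Y.C) :
    Y.IsUniformization ψ ((f : X.E →+ Y.E).comp u) where
  contMDiff := ContMDiff.comp (I' := 𝓘(ℂ, ℂ)) (g := f) (f := u) hf hu.contMDiff
  surjective := f.surjective.comp hu.surjective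
  ker_eq := by
    rw [← hu.ker_eq]
    ext z
    simp [AddMonoidHom.mem_ker]
  C_eq := by
    rw [← hC, hu.C_eq, AddMonoidHom.map_zmultiples]
    rfl

variable [NeZero n]

/-- A uniformization with period lattice `L_ψ` and normalized differential identifies the triple
with `F_n(π_n(ψ))`. -/
theorem toCan_eq (hu : X.IsUniformization ψ u) (hn : X.IsNormalized u) :
    X.toCan = F n (Ln.pi n ψ) := by
  have hker : (Ln.pi n ψ).L ≤ u.ker := hu.ker_eq.ge
  let f₀ : (Ln.pi n ψ).toTriple.E →+ X.E := QuotientAddGroup.lift (Ln.pi n ψ).L u hker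
  have hf₀ : ∀ z, f₀ ((Ln.pi n ψ).proj z) = u z := fun z => rfl
  have hinj : Function.Injective f₀ := by
    rw [injective_iff_map_eq_zero]
    intro q hq
    obtain ⟨z, rfl⟩ := (Ln.pi n ψ).proj_surjective q
    rw [hf₀, ← AddMonoidHom.mem_ker, hu.ker_eq] at hq
    rw [← AddMonoidHom.mem_ker, Ln.ker_proj]
    exact hq
  have hsurj : Function.Surjective f₀ := fun P => by
    obtain ⟨z, rfl⟩ := hu.surjective P
    exact ⟨_, hf₀ z⟩
  let f : (Ln.pi n ψ).toTriple.E ≃+ X.E := AddEquiv.ofBijective f₀ ⟨hinj, hsurj⟩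
  have hf : IsHol (Ln.pi n ψ).toTriple X f :=
    Torus.contMDiff_of_comp_mk (L := (Ln.pi n ψ).L) hu.contMDiff
  have hp : PullsBack (Ln.pi n ψ).toTriple X f := Ln.pullsBack_of_comp_proj hf hn
  refine (Quotient.sound (s := ⟨Triple.Iso, Triple.iso_equivalence⟩)
    ⟨f, hf, IsHol.symm hf hp, ?_, hp⟩).symm
  rw [hu.C_eq]
  have h1 : (Ln.pi n ψ).toTriple.C = AddSubgroup.zmultiples
      ((Ln.pi n ψ).proj ((n : ℂ)⁻¹ * ψ.hom ![0, 1])) := Ln.map_eq_zmultiples ψ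
  rw [h1, AddMonoidHom.map_zmultiples]
  rfl

theorem proj (ψ : LQ) : (Ln.pi n ψ).toTriple.IsUniformization ψ (Ln.pi n ψ).proj where
  contMDiff := Ln.contMDiff_proj _
  surjective := Ln.proj_surjective _
  ker_eq := Ln.ker_proj _
  C_eq := Ln.map_eq_zmultiples ψ

end IsUniformization

end Triple

namespace Ln

variable {n : ℕ}

/-- A homomorphism `ℂ → ℂ/L` along which `2πi dz` pulls back to `2πi dz` is the projection. -/
theorem eq_proj_of_isNormalized {p : Ln n} {u : ℂ →+ p.toTriple.E}
    (hu : ContMDiff 𝓘(ℂ, ℂ) 𝓘(ℂ, ℂ) ω u) (hn : p.toTriple.IsNormalized u) : u = p.proj := by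
  refine Triple.hom_eq_of_eventuallyEq ?_
  let e : OpenPartialHomeomorph (ℂ ⧸ p.L) ℂ := chartAt ℂ (0 : ℂ ⧸ p.L)
  have he : ∀ q ∈ e.source, p.proj (e q) = q := fun q hq =>
    Torus.mk_atlas (chart_mem_atlas ℂ _) hq
  have hV : u ⁻¹' e.source ∈ nhds (0 : ℂ) := by
    refine hu.continuous.continuousAt.preimage_mem_nhds (e.open_source.mem_nhds ?_)
    rw [map_zero]
    exact mem_chart_source ℂ (0 : ℂ ⧸ p.L)
  obtain ⟨r, hr, hrV⟩ := Metric.mem_nhds_iff.1 hV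
  -- The local lift `s` of `u` has derivative one, so it is a translation by `s 0 ∈ L`.
  let s : ℂ → ℂ := fun z => e (u z)
  have hs : ∀ z ∈ Metric.ball (0 : ℂ) r, p.proj (s z) = u z := fun z hz => he _ (hrV hz)
  have hd : ∀ z ∈ Metric.ball (0 : ℂ) r, HasDerivAt s 1 z := by
    intro z hz
    have h1 : ContMDiffAt 𝓘(ℂ, ℂ) 𝓘(ℂ, ℂ) ω e (u z) :=
      (contMDiffOn_chart (I := 𝓘(ℂ, ℂ)) (n := ω) (x := (0 : ℂ ⧸ p.L))).contMDiffAt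
        (e.open_source.mem_nhds (hrV hz))
    have h2 : DifferentiableAt ℂ s z :=
      mdifferentiableAt_iff_differentiableAt.1
        (((ContMDiffAt.comp z h1 (hu z))).mdifferentiableAt (by simp))
    have h3 := Triple.pullbackCoeff_comp_right p.contMDiff_proj h2.hasDerivAt
    have h4 : p.toTriple.pullbackCoeff (p.proj ∘ s) z = p.toTriple.pullbackCoeff u z := by
      have h5 : p.proj ∘ s =ᶠ[nhds z] u := by
        filter_upwards [Metric.isOpen_ball.mem_nhds hz] with w hw using hs w hw
      have h6 := h5.self_of_nhds
      unfold Triple.pullbackCoeff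
      rw [h5.mfderiv_eq, h6]
    rw [h4, hn, pullbackCoeff_proj] at h3
    have h7 := mul_right_cancel₀ Complex.two_pi_I_ne_zero ((one_mul _).trans h3)
    rw [h7]
    exact h2.hasDerivAt
  have hc : ∀ z ∈ Metric.ball (0 : ℂ) r, s z - z = s 0 - 0 := fun z hz =>
    (convex_ball (0 : ℂ) r).is_const_of_fderivWithin_eq_zero (𝕜 := ℂ) (f := fun z => s z - z)
      (fun w hw => ((hd w hw).sub (hasDerivAt_id w)).differentiableAt.differentiableWithinAt)
      (fun w hw => by
        rw [fderivWithin_of_isOpen Metric.isOpen_ball hw]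
        have := (hd w hw).sub (hasDerivAt_id w)
        rw [sub_self] at this
        have h2 := this.hasFDerivAt.fderiv
        simp at h2
        exact h2)
      hz (Metric.mem_ball_self hr)
  filter_upwards [Metric.ball_mem_nhds (0 : ℂ) hr] with z hz
  have h0 := hs 0 (Metric.mem_ball_self hr)
  rw [map_zero] at h0
  have h1 : s z = z + s 0 := by linear_combination hc z hz
  rw [← hs z hz, h1, map_add, h0, add_zero]

end Ln

/-- Triples of the form `(ℂ/L, L'/L, 2πi dz)` are isomorphic only if they are equal. -/
theorem F_injective (n : ℕ) : Function.Injective (F n) := by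
  intro p p' h
  obtain ⟨f, hf, -, hC, hp⟩ := Quotient.exact h
  have h1 : (f : p.toTriple.E →+ p'.toTriple.E).comp p.proj = p'.proj := by
    refine Ln.eq_proj_of_isNormalized
      (ContMDiff.comp (I' := 𝓘(ℂ, ℂ)) (g := f) (f := p.proj) hf p.contMDiff_proj) fun z => ?_
    exact (Triple.PullsBack.pullbackCoeff hp hf p.contMDiff_proj z).trans (p.pullbackCoeff_proj z)
  have hL : p.L = p'.L := by
    rw [← p.ker_proj, ← p'.ker_proj, ← h1]
    ext z
    simp [AddMonoidHom.mem_ker]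
  -- The lattice `L'` is recovered as the preimage of `L'/L`.
  have key : ∀ p : Ln n, p.toTriple.C.comap p.proj = p.L' := by
    intro p
    refine (AddSubgroup.comap_map_eq _ _).trans ?_
    rw [Ln.ker_proj, sup_eq_left]
    exact p.le
  refine Ln.ext hL ?_
  rw [← key p, ← key p', ← h1, ← hC, ← AddSubgroup.comap_comap]
  congr 1
  exact (AddSubgroup.comap_map_eq_self_of_injective f.injective _).symm

namespace Triple

variable {n : ℕ} [NeZero n] {X : Triple n} {ψ : LQ}

/-- A pair in the class of `(ℂ/L_ψ, L_{γ_n ψ}/L_ψ)` has a uniformization by `ψ`. -/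
theorem exists_isUniformization (h : X.toCan.forget = (F n (Ln.pi n ψ)).forget) :
    ∃ u : ℂ →+ X.E, X.IsUniformization ψ u := by
  obtain ⟨f, -, hf, hC⟩ := Quotient.exact h
  exact ⟨_, (IsUniformization.proj ψ).comp_equiv hf (map_symm hC)⟩

theorem exists_isUniformization_isNormalized (h : X.toCan = F n (Ln.pi n ψ)) :
    ∃ u : ℂ →+ X.E, X.IsUniformization ψ u ∧ X.IsNormalized u := by
  obtain ⟨f, hf', hf, hC, hp⟩ := Quotient.exact h
  refine ⟨_, (IsUniformization.proj ψ).comp_equiv hf (map_symm hC), fun z => ?_⟩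
  exact (PullsBack.pullbackCoeff (hp.symm hf' hf) hf (Ln.contMDiff_proj _) z).trans
    (Ln.pullbackCoeff_proj _ z)

end Triple

/-! ### Parametrizations of the torsion by uniformizations -/

/-- Every `γ ∈ GL₂(ℚ)⁺` is a rational multiple of an integral matrix of positive determinant. -/
theorem exists_eq_smul_map_intCast (γ : GL(2, ℚ)⁺) :
    ∃ (a : ℚ) (g : Matrix (Fin 2) (Fin 2) ℤ) (δ : ℕ), a ≠ 0 ∧ 0 < δ ∧ g.det = δ ∧
      (γ.1 : Matrix (Fin 2) (Fin 2) ℚ) = a • g.map (Int.cast : ℤ → ℚ) := by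
  set A := (γ.1 : Matrix (Fin 2) (Fin 2) ℚ)
  have hden : (A.den : ℚ) ≠ 0 := by exact_mod_cast A.den_ne_zero
  have hnum : A = (A.den : ℚ)⁻¹ • A.num.map (Int.cast : ℤ → ℚ) := A.inv_denom_smul_num.symm
  have hpos : 0 < A.num.det := by
    have h1 : 0 < A.det := LQ.det_pos γ
    have h2 : (A.num.map (Int.cast : ℤ → ℚ)).det = (A.num.det : ℚ) :=
      (RingHom.map_det (Int.castRingHom ℚ) A.num).symm
    rw [hnum, Matrix.det_smul, h2, Fintype.card_fin] at h1
    exact_mod_cast pos_of_mul_pos_right h1 (by positivity)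
  exact ⟨(A.den : ℚ)⁻¹, A.num, A.num.det.toNat, inv_ne_zero hden, by omega, by omega, hnum⟩

section Division

variable {A : Type*} [AddCommGroup A]

/-- The homomorphism `(x, y) ↦ u(ψ(x/N, y/N))` on `(ℤ/N)²`, for `u` vanishing on `L_ψ`. -/
def divisionHom (u : ℂ →+ A) (ψ : LQ) (h : ψ.lattice ≤ u.ker) (N : ℕ) [NeZero N] :
    (Fin 2 → ZMod N) →+ A :=
  have key : ∀ z ∈ ψ.lattice, zmultiplesHom A (u ((N : ℂ)⁻¹ * z)) N = 0 := fun z hz => by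
    have hN : (N : ℂ) ≠ 0 := by exact_mod_cast NeZero.ne N
    rw [zmultiplesHom_apply, ← map_zsmul, zsmul_eq_mul, Int.cast_natCast,
      mul_inv_cancel_left₀ hN]
    exact h hz
  (ZMod.lift N ⟨zmultiplesHom A (u ((N : ℂ)⁻¹ * ψ.hom ![1, 0])),
      key _ (LQ.mem_lattice.2 ⟨1, 0, by simp⟩)⟩).comp (Pi.evalAddMonoidHom _ 0) +
    (ZMod.lift N ⟨zmultiplesHom A (u ((N : ℂ)⁻¹ * ψ.hom ![0, 1])),
      key _ (LQ.mem_lattice.2 ⟨0, 1, by simp⟩)⟩).comp (Pi.evalAddMonoidHom _ 1)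

variable {u : ℂ →+ A} {ψ : LQ} {N : ℕ}

theorem exists_intCast_eq (v : Fin 2 → ZMod N) :
    ∃ x y : ℤ, v = ![(x : ZMod N), (y : ZMod N)] := by
  obtain ⟨x, hx⟩ := ZMod.intCast_surjective (v 0)
  obtain ⟨y, hy⟩ := ZMod.intCast_surjective (v 1)
  refine ⟨x, y, ?_⟩
  ext i
  fin_cases i
  · exact hx.symm
  · exact hy.symm

variable [NeZero N]

theorem divisionHom_intCast (h : ψ.lattice ≤ u.ker) (x y : ℤ) :
    divisionHom u ψ h N ![(x : ZMod N), (y : ZMod N)] =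
      u ((N : ℂ)⁻¹ * (x * ψ.hom ![1, 0] + y * ψ.hom ![0, 1])) := by
  simp only [divisionHom, AddMonoidHom.add_apply, AddMonoidHom.comp_apply,
    Pi.evalAddMonoidHom_apply, Matrix.cons_val_zero, Matrix.cons_val_one, ZMod.lift_coe,
    zmultiplesHom_apply]
  rw [← map_zsmul, ← map_zsmul, ← map_add, zsmul_eq_mul, zsmul_eq_mul]
  congr 1
  ring

theorem divisionHom_injective (h : u.ker = ψ.lattice) :
    Function.Injective (divisionHom u ψ h.ge N) := by
  have hN : (N : ℂ) ≠ 0 := by exact_mod_cast NeZero.ne N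
  rw [injective_iff_map_eq_zero]
  intro v hv
  obtain ⟨x, y, rfl⟩ := exists_intCast_eq v
  rw [divisionHom_intCast, ← AddMonoidHom.mem_ker, h] at hv
  obtain ⟨x', y', hxy⟩ := LQ.mem_lattice.1 hv
  have := ψ.int_ext (x := N * x') (y := N * y') (x' := x) (y' := y) (by
    push_cast
    rw [eq_inv_mul_iff_mul_eq₀ hN] at hxy
    linear_combination hxy)
  rw [← this.1, ← this.2]
  ext i
  fin_cases i <;> simp

/-- The image of `divisionHom` is the `N`-torsion subgroup. -/
theorem mem_range_divisionHom (h : u.ker = ψ.lattice) (hs : Function.Surjective u) (P : A) :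
    P ∈ (divisionHom u ψ h.ge N).range ↔ N • P = 0 := by
  have hN : (N : ℂ) ≠ 0 := by exact_mod_cast NeZero.ne N
  constructor
  · rintro ⟨v, rfl⟩
    have h0 : N • v = 0 := by
      ext i
      simp
    rw [← map_nsmul, h0, map_zero]
  · intro hP
    obtain ⟨z, rfl⟩ := hs P
    rw [← map_nsmul, ← AddMonoidHom.mem_ker, h, nsmul_eq_mul] at hP
    obtain ⟨x, y, hxy⟩ := LQ.mem_lattice.1 hP
    refine ⟨![(x : ZMod N), (y : ZMod N)], ?_⟩
    rw [divisionHom_intCast, hxy, inv_mul_cancel_left₀ hN]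

end Division

namespace Choice

variable {n : ℕ} {γ : GL(2, ℚ)⁺} {X : Triple n}

/-- The isomorphism `φ` of the choice is `(x, y) ↦ u(ψ(x/nδ, y/nδ))`. -/
def IsMarkedBy (c : Choice γ X) (ψ : LQ) (u : ℂ →+ X.E) : Prop :=
  ∀ x y : ℤ, c.φ ![(x : ZMod (n * c.δ)), (y : ZMod (n * c.δ))] =
    u (((n * c.δ : ℕ) : ℂ)⁻¹ * (x * ψ.hom ![1, 0] + y * ψ.hom ![0, 1]))

theorem hom_div (ψ : LQ) (x y : ℤ) (N : ℕ) : ψ.hom ![(x : ℚ) / N, (y : ℚ) / N] =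
    (N : ℂ)⁻¹ * (x * ψ.hom ![1, 0] + y * ψ.hom ![0, 1]) := by
  rw [ψ.apply]
  simp
  ring

theorem isOriented_iff {c : Choice γ X} : c.IsOriented ↔
    ∃ (ψ : LQ) (u : ℂ →+ X.E), ContMDiff 𝓘(ℂ, ℂ) 𝓘(ℂ, ℂ) ω u ∧ Function.Surjective u ∧
      u.ker = ψ.lattice ∧ c.IsMarkedBy ψ u := by
  simp only [IsOriented, IsMarkedBy, hom_div]

theorem IsMarkedBy.homothety {c : Choice γ X} {ψ : LQ} {u u' : ℂ →+ X.E}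
    (h : c.IsMarkedBy ψ u) {b : ℂ} (hb : b ≠ 0) (hu : ∀ z, u' (b * z) = u z) :
    c.IsMarkedBy (LQ.homothety b hb ψ) u' := by
  intro x y
  rw [h, LQ.homothety_hom, LQ.homothety_hom, ← hu]
  congr 1
  ring

variable [NeZero n]

/-- A uniformization that marks a choice is adapted to `C`, because `φ(0, δ) = u(ψ(0, 1/n))`
generates `C`. -/
theorem IsMarkedBy.isUniformization {c : Choice γ X} {ψ : LQ} {u : ℂ →+ X.E}
    (h : c.IsMarkedBy ψ u) (hu : ContMDiff 𝓘(ℂ, ℂ) 𝓘(ℂ, ℂ) ω u) (hs : Function.Surjective u)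
    (hk : u.ker = ψ.lattice) : X.IsUniformization ψ u := by
  refine ⟨hu, hs, hk, ?_⟩
  have hn : (n : ℂ) ≠ 0 := by exact_mod_cast NeZero.ne n
  have hδ : (c.δ : ℂ) ≠ 0 := by exact_mod_cast c.δ_pos.ne'
  have h1 := h 0 c.δ
  rw [← c.C_eq]
  simp only [Int.cast_zero, Int.cast_natCast] at h1
  rw [h1]
  congr 2
  push_cast
  field_simp
  ring

/-- The choice with given `γ = a g` and `φ(x, y) = u(ψ(x/nδ, y/nδ))`. -/
def ofUniformization {ψ : LQ} {u : ℂ →+ X.E} (hu : X.IsUniformization ψ u) (a : ℚ) (ha : a ≠ 0)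
    (g : Matrix (Fin 2) (Fin 2) ℤ) (δ : ℕ) (hδ : 0 < δ) (hdet : g.det = δ)
    (hγ : (γ.1 : Matrix (Fin 2) (Fin 2) ℚ) = a • g.map (Int.cast : ℤ → ℚ)) : Choice γ X :=
  haveI : NeZero (n * δ) := ⟨mul_ne_zero (NeZero.ne n) hδ.ne'⟩
  { a := a
    a_ne_zero := ha
    g := g
    δ := δ
    δ_pos := hδ
    det_eq := hdet
    eq_smul := hγ
    φ := divisionHom u ψ hu.ker_eq.ge (n * δ)
    injective := divisionHom_injective hu.ker_eq
    mem_range := mem_range_divisionHom hu.ker_eq hu.surjective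
    C_eq := by
      have hn : (n : ℂ) ≠ 0 := by exact_mod_cast NeZero.ne n
      have hδ : (δ : ℂ) ≠ 0 := by exact_mod_cast hδ.ne'
      have h1 := divisionHom_intCast (N := n * δ) hu.ker_eq.ge 0 δ
      simp only [Int.cast_zero, Int.cast_natCast] at h1
      rw [h1, hu.C_eq]
      congr 2
      push_cast
      field_simp
      ring }

theorem isMarkedBy_ofUniformization {ψ : LQ} {u : ℂ →+ X.E} (hu : X.IsUniformization ψ u)
    (a : ℚ) (ha : a ≠ 0) (g : Matrix (Fin 2) (Fin 2) ℤ) (δ : ℕ) (hδ : 0 < δ) (hdet : g.det = δ)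
    (hγ : (γ.1 : Matrix (Fin 2) (Fin 2) ℚ) = a • g.map (Int.cast : ℤ → ℚ)) :
    (ofUniformization hu a ha g δ hδ hdet hγ).IsMarkedBy ψ u :=
  haveI : NeZero (n * δ) := ⟨mul_ne_zero (NeZero.ne n) hδ.ne'⟩
  divisionHom_intCast (N := n * δ) hu.ker_eq.ge

end Choice

/-! ### The construction in terms of lattices -/

theorem AddSubgroup.map_sup_of_ker_eq {A B : Type*} [AddCommGroup A] [AddCommGroup B]
    {q : A →+ B} {S T : AddSubgroup A} (h : q.ker = T) : (S ⊔ T).map q = S.map q := by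
  rw [AddSubgroup.map_sup, (AddSubgroup.map_eq_bot_iff T).2 h.ge, sup_bot_eq]

namespace Choice

variable {n : ℕ} {γ : GL(2, ℚ)⁺} {X : Triple n} {c : Choice γ X} {ψ : LQ} {u : ℂ →+ X.E}

theorem det_eq_sq_mul (c : Choice γ X) :
    (γ.1 : Matrix (Fin 2) (Fin 2) ℚ).det = c.a ^ 2 * c.δ := by
  have h1 : (c.g.map (Int.cast : ℤ → ℚ)).det = (c.g.det : ℚ) :=
    (RingHom.map_det (Int.castRingHom ℚ) c.g).symm
  rw [c.eq_smul, Matrix.det_smul, Fintype.card_fin, h1, c.det_eq, Int.cast_natCast]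

theorem smul_hom (c : Choice γ X) (ψ : LQ) (x y : ℚ) : (γ • ψ).hom ![x, y] =
    ((c.a : ℂ) * c.δ)⁻¹ * ((x * c.g 0 0 + y * c.g 1 0) * ψ.hom ![1, 0] +
      (x * c.g 0 1 + y * c.g 1 1) * ψ.hom ![0, 1]) := by
  have ha : (c.a : ℂ) ≠ 0 := by exact_mod_cast c.a_ne_zero
  have hδ : (c.δ : ℂ) ≠ 0 := by exact_mod_cast c.δ_pos.ne'
  rw [LQ.smul_apply, ψ.apply, c.det_eq_sq_mul, c.eq_smul]
  simp [Matrix.vecMul, dotProduct, Fin.sum_univ_two]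
  field_simp

/-- The homomorphism `gψ = a(γψ)`, where `γ = a g`. -/
def smulInt (c : Choice γ X) (ψ : LQ) : LQ :=
  LQ.homothety c.a (by exact_mod_cast c.a_ne_zero) (γ • ψ)

theorem smulInt_fst (c : Choice γ X) (ψ : LQ) : (c.smulInt ψ).hom ![1, 0] =
    (c.δ : ℂ)⁻¹ * (c.g 0 0 * ψ.hom ![1, 0] + c.g 0 1 * ψ.hom ![0, 1]) := by
  have ha : (c.a : ℂ) ≠ 0 := by exact_mod_cast c.a_ne_zero
  rw [smulInt, LQ.homothety_hom, c.smul_hom]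
  simp
  field_simp

theorem smulInt_snd (c : Choice γ X) (ψ : LQ) : (c.smulInt ψ).hom ![0, 1] =
    (c.δ : ℂ)⁻¹ * (c.g 1 0 * ψ.hom ![1, 0] + c.g 1 1 * ψ.hom ![0, 1]) := by
  have ha : (c.a : ℂ) ≠ 0 := by exact_mod_cast c.a_ne_zero
  rw [smulInt, LQ.homothety_hom, c.smul_hom]
  simp
  field_simp

/-- Since `δ g⁻¹` is integral, `L_ψ ⊆ L_{gψ}`. -/
theorem lattice_le_lattice_smulInt (c : Choice γ X) (ψ : LQ) :
    ψ.lattice ≤ (c.smulInt ψ).lattice := by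
  intro z hz
  have hδ : (c.δ : ℂ) ≠ 0 := by exact_mod_cast c.δ_pos.ne'
  have hdet : (c.g 0 0 : ℂ) * c.g 1 1 - c.g 0 1 * c.g 1 0 = c.δ := by
    have := c.det_eq
    rw [Matrix.det_fin_two] at this
    exact_mod_cast this
  obtain ⟨x, y, rfl⟩ := LQ.mem_lattice.1 hz
  refine LQ.mem_lattice.2 ⟨x * c.g 1 1 - y * c.g 1 0, y * c.g 0 0 - x * c.g 0 1, ?_⟩
  rw [smulInt_fst, smulInt_snd]
  push_cast
  field_simp
  linear_combination (x * ψ.hom ![1, 0] + y * ψ.hom ![0, 1]) * hdet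

theorem IsMarkedBy.row_zero (h : c.IsMarkedBy ψ u) :
    c.row 0 = u ((n : ℂ)⁻¹ * (c.smulInt ψ).hom ![1, 0]) := by
  have e : (fun j => (c.g 0 j : ZMod (n * c.δ))) =
      ![(c.g 0 0 : ZMod (n * c.δ)), (c.g 0 1 : ZMod (n * c.δ))] := by
    ext j; fin_cases j <;> rfl
  rw [row, e, h, smulInt_fst]
  congr 1
  push_cast
  rw [mul_inv]
  ring

theorem IsMarkedBy.row_one (h : c.IsMarkedBy ψ u) :
    c.row 1 = u ((n : ℂ)⁻¹ * (c.smulInt ψ).hom ![0, 1]) := by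
  have e : (fun j => (c.g 1 j : ZMod (n * c.δ))) =
      ![(c.g 1 0 : ZMod (n * c.δ)), (c.g 1 1 : ZMod (n * c.δ))] := by
    ext j; fin_cases j <;> rfl
  rw [row, e, h, smulInt_snd]
  congr 1
  push_cast
  rw [mul_inv]
  ring

variable [NeZero n]

/-- In terms of a uniformization, `C_γ` is the image of the lattice `L_{gψ}`. -/
theorem IsMarkedBy.Cγ_eq (h : c.IsMarkedBy ψ u) : c.Cγ = (c.smulInt ψ).lattice.map u := by
  have hn : (n : ℂ) ≠ 0 := by exact_mod_cast NeZero.ne n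
  have key : ∀ z, nsmulAddMonoidHom n (u ((n : ℂ)⁻¹ * z)) = u z := fun z => by
    rw [nsmulAddMonoidHom_apply, ← map_nsmul, nsmul_eq_mul, mul_inv_cancel_left₀ hn]
  rw [Cγ, AddMonoidHom.map_closure, LQ.lattice, AddMonoidHom.map_closure, Set.image_pair,
    Set.image_pair, h.row_zero, h.row_one, key, key]

theorem IsMarkedBy.comap_Cγ (h : c.IsMarkedBy ψ u) (hk : u.ker = ψ.lattice) :
    c.Cγ.comap u = (c.smulInt ψ).lattice := by
  rw [h.Cγ_eq, AddSubgroup.comap_map_eq, hk, sup_eq_left]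
  exact c.lattice_le_lattice_smulInt ψ

/-- The triple obtained from a choice that comes from a normalized uniformization by `ψ` has a
normalized uniformization by `γψ`. -/
theorem IsQuotient.isUniformization {X' : Triple n} {q : X.E →+ X'.E} (hq : c.IsQuotient X' q)
    (h : c.IsMarkedBy ψ u) (hu : X.IsUniformization ψ u) (hnorm : X.IsNormalized u) :
    ∃ u' : ℂ →+ X'.E, (X'.scale c.a c.a_ne_zero).IsUniformization (γ • ψ) u' ∧
      (X'.scale c.a c.a_ne_zero).IsNormalized u' := by
  obtain ⟨hhol, hsurj, hker, hC, hpull⟩ := hq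
  have ha : (c.a : ℂ) ≠ 0 := by exact_mod_cast c.a_ne_zero
  have hmul : ContMDiff 𝓘(ℂ, ℂ) 𝓘(ℂ, ℂ) ω (fun z : ℂ => (c.a : ℂ) * z) :=
    contMDiff_iff_contDiff.2 (by fun_prop)
  have hqu : ContMDiff 𝓘(ℂ, ℂ) 𝓘(ℂ, ℂ) ω (q ∘ u) :=
    ContMDiff.comp (I' := 𝓘(ℂ, ℂ)) (g := q) (f := u) hhol hu.contMDiff
  -- The factor `a` accounts for `L_{γψ} = a⁻¹ L_{gψ}` and for the differential `a⁻¹ ω'`.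
  refine ⟨(q.comp u).comp (AddMonoidHom.mulLeft (c.a : ℂ)), ⟨?_, ?_, ?_, ?_⟩, ?_⟩
  · exact hqu.comp hmul
  · intro P
    obtain ⟨Q, rfl⟩ := hsurj P
    obtain ⟨z, rfl⟩ := hu.surjective Q
    exact ⟨(c.a : ℂ)⁻¹ * z, congrArg (fun w => q (u w)) (mul_inv_cancel_left₀ ha z)⟩
  · ext z
    have h1 : (c.a : ℂ) * z ∈ c.Cγ.comap u ↔ z ∈ (γ • ψ).lattice := by
      rw [h.comap_Cγ hu.ker_eq, smulInt, LQ.mem_lattice_homothety, inv_mul_cancel_left₀ ha]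
    rw [← h1, ← hker]
    rfl
  · change X'.C = _
    rw [hC, AddSubgroup.map_sup_of_ker_eq hker, AddMonoidHom.map_zmultiples, h.row_one, smulInt,
      LQ.homothety_hom, mul_left_comm]
    rfl
  · intro z
    have h1 : X'.pullbackCoeff ((q ∘ u) ∘ fun z : ℂ => (c.a : ℂ) * z) z =
        c.a * (2 * Real.pi * Complex.I) := by
      have hd : HasDerivAt (fun z : ℂ => (c.a : ℂ) * z) c.a z := by
        simpa using (hasDerivAt_id z).const_mul (c.a : ℂ)
      rw [Triple.pullbackCoeff_comp_right hqu hd,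
        Triple.PullsBack.pullbackCoeff hpull hhol hu.contMDiff, hnorm]
    have h2 : (c.a : ℂ)⁻¹ * X'.pullbackCoeff ((q ∘ u) ∘ fun z : ℂ => (c.a : ℂ) * z) z =
        2 * Real.pi * Complex.I := by
      rw [h1, inv_mul_cancel_left₀ ha]
    exact h2

/-- The value of the construction for a normalized marking by `ψ` is the class of the lattice pair
`π_n(γψ)`. -/
theorem Yields.eq {y : Can n} (hy : c.Yields y) (h : c.IsMarkedBy ψ u)
    (hu : X.IsUniformization ψ u) (hnorm : X.IsNormalized u) : y = F n (Ln.pi n (γ • ψ)) := by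
  obtain ⟨X', q, hq, rfl⟩ := hy
  obtain ⟨u', hu', hn'⟩ := hq.isUniformization h hu hnorm
  exact hu'.toCan_eq hn'

/-- The quotient required by the construction exists for the triple `(ℂ/L, L'/L, 2πi dz)`. -/
theorem exists_yields {c : Choice γ (Ln.pi n ψ).toTriple}
    (h : c.IsMarkedBy ψ (Ln.pi n ψ).proj) : ∃ y, c.Yields y := by
  let p' := Ln.pi n (c.smulInt ψ)
  have hk' : p'.proj.ker = (c.smulInt ψ).lattice := p'.ker_proj
  let q : (Ln.pi n ψ).toTriple.E →+ p'.toTriple.E := QuotientAddGroup.lift (Ln.pi n ψ).L p'.proj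
    ((c.lattice_le_lattice_smulInt ψ).trans hk'.ge)
  have hqp : ∀ z, q ((Ln.pi n ψ).proj z) = p'.proj z := fun z => rfl
  have hhol : Triple.IsHol (Ln.pi n ψ).toTriple p'.toTriple q :=
    Torus.contMDiff_of_comp_mk (L := (Ln.pi n ψ).L) p'.contMDiff_proj
  have hker : q.ker = c.Cγ := by
    ext P
    obtain ⟨z, rfl⟩ := (Ln.pi n ψ).proj_surjective P
    rw [AddMonoidHom.mem_ker, hqp, ← AddMonoidHom.mem_ker, hk',
      ← h.comap_Cγ (Ln.pi n ψ).ker_proj]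
    rfl
  refine ⟨_, p'.toTriple, q, ⟨hhol, fun P => ?_, hker, ?_, ?_⟩, rfl⟩
  · obtain ⟨z, rfl⟩ := p'.proj_surjective P
    exact ⟨_, hqp z⟩
  · rw [AddSubgroup.map_sup_of_ker_eq hker, AddMonoidHom.map_zmultiples, h.row_one]
    exact Ln.map_eq_zmultiples (c.smulInt ψ)
  · exact Ln.pullsBack_of_comp_proj hhol p'.pullbackCoeff_proj

end Choice

/-! ### Change of the parametrization of the torsion -/

section Level

variable {A : Type*} [AddCommGroup A] {N : ℕ}

/-- The composition of `φ` with the reduction `ℤ² → (ℤ/N)²`. -/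
def intHom (φ : (Fin 2 → ZMod N) →+ A) : (Fin 2 → ℤ) →+ A :=
  φ.comp ((Int.castAddHom (ZMod N)).compLeft (Fin 2))

theorem intHom_apply (φ : (Fin 2 → ZMod N) →+ A) (v : Fin 2 → ℤ) :
    intHom φ v = φ fun j => (v j : ZMod N) := rfl

theorem intHom_eq_iff {φ : (Fin 2 → ZMod N) →+ A} (hφ : Function.Injective φ)
    {v w : Fin 2 → ℤ} : intHom φ v = intHom φ w ↔ ∀ j, (v j : ZMod N) = w j :=
  hφ.eq_iff.trans funext_iff

theorem intHom_vecMul (φ : (Fin 2 → ZMod N) →+ A) (v : Fin 2 → ℤ)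
    (h : Matrix (Fin 2) (Fin 2) ℤ) :
    intHom φ (Matrix.vecMul v h) = v 0 • intHom φ (h 0) + v 1 • intHom φ (h 1) := by
  rw [← map_zsmul, ← map_zsmul, ← map_add]
  congr 1
  ext j
  simp [Matrix.vecMul, dotProduct]

variable {φ φ₀ : (Fin 2 → ZMod N) →+ A}

/-- Two parametrizations of the torsion differ by an integral matrix. -/
theorem exists_intHom_eq_vecMul (hr : φ.range ≤ φ₀.range) :
    ∃ h : Matrix (Fin 2) (Fin 2) ℤ, ∀ v, intHom φ v = intHom φ₀ (Matrix.vecMul v h) := by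
  have h1 : ∀ v : Fin 2 → ℤ, ∃ w : Fin 2 → ℤ, intHom φ₀ w = intHom φ v := fun v => by
    obtain ⟨w, hw⟩ := hr ⟨_, rfl⟩
    choose w' hw' using fun j => ZMod.intCast_surjective (w j)
    refine ⟨w', ?_⟩
    rw [intHom_apply, funext hw']
    exact hw
  choose f hf using h1
  let h : Matrix (Fin 2) (Fin 2) ℤ := Matrix.of fun i => f ((1 : Matrix (Fin 2) (Fin 2) ℤ) i)
  have hh : ∀ i, intHom φ₀ (h i) = intHom φ ((1 : Matrix (Fin 2) (Fin 2) ℤ) i) := fun i => hf _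
  refine ⟨h, fun v => ?_⟩
  rw [intHom_vecMul, hh, hh, ← intHom_vecMul, Matrix.vecMul_one]

/-- Matrices that are inverse to each other modulo `N` have determinants prime to `N`. -/
theorem isCoprime_det_of_vecMul (hφ : Function.Injective φ) {h h' : Matrix (Fin 2) (Fin 2) ℤ}
    (h1 : ∀ v, intHom φ v = intHom φ₀ (Matrix.vecMul v h))
    (h2 : ∀ v, intHom φ₀ v = intHom φ (Matrix.vecMul v h')) : IsCoprime h.det (N : ℤ) := by
  have e : (Int.castRingHom (ZMod N)).mapMatrix (h * h') = 1 := by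
    ext i j
    have e1 := h1 ((1 : Matrix (Fin 2) (Fin 2) ℤ) i)
    rw [h2, Matrix.vecMul_vecMul, intHom_eq_iff hφ] at e1
    have e2 := e1 j
    rw [← Matrix.mul_apply_eq_vecMul, one_mul] at e2
    change (((h * h') i j : ℤ) : ZMod N) = (1 : Matrix (Fin 2) (Fin 2) (ZMod N)) i j
    refine e2.symm.trans ?_
    rw [Matrix.one_apply, Matrix.one_apply]
    split_ifs <;> simp
  have e3 := congrArg Matrix.det e
  rw [← RingHom.map_det, Matrix.det_one, Matrix.det_mul] at e3
  have e4 : ((h.det * h'.det - 1 : ℤ) : ZMod N) = 0 := by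
    rw [Int.cast_sub, Int.cast_one, sub_eq_zero]
    exact e3
  obtain ⟨k, hk⟩ := (ZMod.intCast_zmod_eq_zero_iff_dvd _ _).1 e4
  exact ⟨h'.det, -k, by linear_combination hk⟩

/-- A base change that preserves the line spanned by `(0, δ)` is lower triangular modulo `n`. -/
theorem dvd_lower_left_of_vecMul {n δ : ℕ} (hδ : 0 < δ) {φ φ₀ : (Fin 2 → ZMod (n * δ)) →+ A}
    (hφ₀ : Function.Injective φ₀)
    {h : Matrix (Fin 2) (Fin 2) ℤ} (h1 : ∀ v, intHom φ v = intHom φ₀ (Matrix.vecMul v h))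
    (hC : φ ![0, (δ : ZMod (n * δ))] ∈ AddSubgroup.zmultiples (φ₀ ![0, (δ : ZMod (n * δ))])) :
    (n : ℤ) ∣ h 1 0 := by
  obtain ⟨k, hk⟩ := AddSubgroup.mem_zmultiples_iff.1 hC
  have e : ∀ φ : (Fin 2 → ZMod (n * δ)) →+ A,
      φ ![0, (δ : ZMod (n * δ))] = intHom φ ![0, (δ : ℤ)] := fun φ => by
    rw [intHom_apply]
    congr 1
    ext j
    fin_cases j <;> simp
  rw [e, e, h1, ← map_zsmul, intHom_eq_iff hφ₀] at hk
  have h2 := hk 0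
  have h3 : ((δ * h 1 0 : ℤ) : ZMod (n * δ)) = 0 := by
    simpa [Matrix.vecMul, dotProduct] using h2.symm
  rw [ZMod.intCast_zmod_eq_zero_iff_dvd] at h3
  have hδ' : (δ : ℤ) ≠ 0 := by exact_mod_cast hδ.ne'
  rw [Nat.cast_mul, mul_comm (n : ℤ)] at h3
  exact (mul_dvd_mul_iff_left hδ').1 h3

end Level

namespace Choice

variable {n : ℕ} {γ : GL(2, ℚ)⁺} {X : Triple n}

/-- If `γ M γ⁻¹ ⊆ M`, then a change of `φ`, which amounts to right multiplication of `g` by an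
element of `M`, changes the rows of `g` by left multiplication by a matrix that is lower triangular
modulo `n`; so `C_γ` and `C'` can only become smaller. -/
theorem subgroups_le_of_preservesLevel (hγ : PreservesLevel n γ) (c : Choice γ X)
    {φ φ' : (Fin 2 → ZMod (n * c.δ)) →+ X.E}
    (hφ : Function.Injective φ) (hφ' : Function.Injective φ') (hr : φ.range = φ'.range)
    (hC : AddSubgroup.zmultiples (φ ![0, (c.δ : ZMod (n * c.δ))]) =
      AddSubgroup.zmultiples (φ' ![0, (c.δ : ZMod (n * c.δ))])) :
    (AddSubgroup.closure {intHom φ (c.g 0), intHom φ (c.g 1)}).map (nsmulAddMonoidHom n) ≤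
      (AddSubgroup.closure {intHom φ' (c.g 0), intHom φ' (c.g 1)}).map (nsmulAddMonoidHom n) ∧
    AddSubgroup.zmultiples (intHom φ (c.g 1)) ≤ AddSubgroup.zmultiples (intHom φ' (c.g 1)) ⊔
      (AddSubgroup.closure {intHom φ' (c.g 0), intHom φ' (c.g 1)}).map (nsmulAddMonoidHom n) := by
  obtain ⟨h, h1⟩ := exists_intHom_eq_vecMul hr.le
  obtain ⟨h', h1'⟩ := exists_intHom_eq_vecMul hr.ge
  have hcop : IsCoprime h.det (n : ℤ) := by
    have := isCoprime_det_of_vecMul hφ h1 h1'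
    rw [Nat.cast_mul] at this
    exact this.of_mul_right_left
  have hdvd : (n : ℤ) ∣ h 1 0 :=
    dvd_lower_left_of_vecMul c.δ_pos hφ' h1 (hC ▸ AddSubgroup.mem_zmultiples _)
  obtain ⟨k, ⟨m, hm⟩, hk⟩ := hγ h hdvd hcop
  -- The scalar `a` cancels from `γ h = k γ`.
  have hgk : c.g * h = k * c.g := by
    rw [c.eq_smul, Matrix.smul_mul, Matrix.mul_smul] at hk
    have h2 := smul_right_injective _ c.a_ne_zero hk
    have h3 : (Int.castRingHom ℚ).mapMatrix (c.g * h) =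
        (Int.castRingHom ℚ).mapMatrix (k * c.g) := by
      rw [map_mul, map_mul]
      exact h2
    exact Matrix.map_injective (f := (Int.castRingHom ℚ)) Int.cast_injective h3
  have hrow : ∀ i, intHom φ (c.g i) =
      k i 0 • intHom φ' (c.g 0) + k i 1 • intHom φ' (c.g 1) := fun i => by
    rw [h1, ← Matrix.mul_apply_eq_vecMul, hgk, Matrix.mul_apply_eq_vecMul, intHom_vecMul]
  have hmem : ∀ i, intHom φ (c.g i) ∈
      AddSubgroup.closure {intHom φ' (c.g 0), intHom φ' (c.g 1)} := fun i => by
    rw [hrow, AddSubgroup.mem_closure_pair]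
    exact ⟨_, _, rfl⟩
  constructor
  · refine AddSubgroup.map_mono ((AddSubgroup.closure_le _).2 ?_)
    rintro _ (rfl | rfl)
    · exact hmem 0
    · exact hmem 1
  · rw [AddSubgroup.zmultiples_le, hrow, hm, add_comm]
    refine AddSubgroup.add_mem_sup ((AddSubgroup.zmultiples _).zsmul_mem
      (AddSubgroup.mem_zmultiples _) _) ⟨m • intHom φ' (c.g 0), ?_, ?_⟩
    · exact AddSubgroup.zsmul_mem _ (AddSubgroup.subset_closure (Set.mem_insert _ _)) _
    · rw [nsmulAddMonoidHom_apply, mul_smul, natCast_zsmul]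

/-- If `γ M γ⁻¹ ⊆ M`, then the values of the construction for two choices with the same
factorization `γ = a g` are the same. -/
theorem isQuotient_of_preservesLevel (hγ : PreservesLevel n γ) (c : Choice γ X)
    (φ' : (Fin 2 → ZMod (n * c.δ)) →+ X.E) (hφ' : Function.Injective φ')
    (hr : ∀ P : X.E, P ∈ φ'.range ↔ (n * c.δ) • P = 0)
    (hC : AddSubgroup.zmultiples (φ' ![0, (c.δ : ZMod (n * c.δ))]) = X.C)
    {X' : Triple n} {q : X.E →+ X'.E} (hq : c.IsQuotient X' q) :
    IsQuotient { c with φ := φ', injective := hφ', mem_range := hr, C_eq := hC } X' q := by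
  have hr' : c.φ.range = φ'.range := by
    ext P
    rw [hr, c.mem_range]
  have h1 := c.subgroups_le_of_preservesLevel hγ c.injective hφ' hr' (c.C_eq.trans hC.symm)
  have h2 := c.subgroups_le_of_preservesLevel hγ hφ' c.injective hr'.symm (hC.trans c.C_eq.symm)
  obtain ⟨hhol, hsurj, hker, hXC, hpull⟩ := hq
  have e1 := le_antisymm h1.1 h2.1
  refine ⟨hhol, hsurj, hker.trans e1, hXC.trans (congrArg (AddSubgroup.map q) ?_), hpull⟩
  exact le_antisymm (sup_le h1.2 (h1.1.trans le_sup_right)) (sup_le h2.2 (h2.1.trans le_sup_right))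

end Choice

/-! ### The action on isomorphism classes of triples -/

section Action

variable {n : ℕ} [NeZero n]

/-- The lattice pair of an oriented uniformization is determined by the class of the triple, because
`F_n` is injective; so the value does not depend on the choices. -/
theorem eq_of_mem_moduliAction {γ : BGamma0 n} {p : Ln n} {y : Can n}
    (hy : y ∈ moduliAction γ.1 (F n p)) : y = F n (γ • p) := by
  obtain ⟨X, c, hX, hor, hy⟩ := hy
  obtain ⟨ψ, u, hu, hs, hk, hm⟩ := Choice.isOriented_iff.1 hor
  obtain ⟨b, hb, u', hu', hn', hbu⟩ := (hm.isUniformization hu hs hk).exists_isNormalized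
  have hp : p = Ln.pi n (LQ.homothety b hb ψ) := F_injective n (hX.symm.trans (hu'.toCan_eq hn'))
  rw [hy.eq (hm.homothety hb hbu) hu' hn', hp, Ln.smul_pi]

theorem moduliAction_nonempty (γ : GL(2, ℚ)⁺) (p : Ln n) : (moduliAction γ (F n p)).Nonempty := by
  obtain ⟨ψ, rfl⟩ := Ln.pi_surjective p
  obtain ⟨a, g, δ, ha, hδ, hdet, hγ⟩ := exists_eq_smul_map_intCast γ
  have hu := Triple.IsUniformization.proj (n := n) ψ
  have hm := Choice.isMarkedBy_ofUniformization hu a ha g δ hδ hdet hγ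
  obtain ⟨y, hy⟩ := Choice.exists_yields hm
  exact ⟨y, _, _, rfl,
    Choice.isOriented_iff.2 ⟨ψ, _, hu.contMDiff, hu.surjective, hu.ker_eq, hm⟩, hy⟩

theorem moduliAction_F (γ : BGamma0 n) (p : Ln n) : moduliAction γ.1 (F n p) = {F n (γ • p)} :=
  Set.eq_singleton_iff_nonempty_unique_mem.2
    ⟨moduliAction_nonempty γ.1 p, fun _ => eq_of_mem_moduliAction⟩

theorem unorientedAction_F (γ : BGamma0 n) (p : Ln n) (hγ : PreservesLevel n γ.1) :
    unorientedAction γ.1 (F n p) = {F n (γ • p)} := by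
  refine Set.eq_singleton_iff_nonempty_unique_mem.2 ⟨?_, ?_⟩
  · obtain ⟨y, X, c, hX, -, hy⟩ := moduliAction_nonempty γ.1 p
    exact ⟨y, X, c, hX, hy⟩
  · rintro y ⟨X, c, hX, X', q, hq, rfl⟩
    obtain ⟨ψ, rfl⟩ := Ln.pi_surjective p
    obtain ⟨u, hu, hn⟩ := Triple.exists_isUniformization_isNormalized hX
    -- Replace `φ` by the oriented isomorphism that comes from a uniformization.
    let c₀ := Choice.ofUniformization hu c.a c.a_ne_zero c.g c.δ c.δ_pos c.det_eq c.eq_smul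
    have hm : c₀.IsMarkedBy ψ u := Choice.isMarkedBy_ofUniformization hu _ _ _ _ _ _ _
    have hq₀ : c₀.IsQuotient X' q :=
      c.isQuotient_of_preservesLevel hγ c₀.φ c₀.injective c₀.mem_range c₀.C_eq hq
    have hy : c₀.Yields (X'.scale c.a c.a_ne_zero).toCan := ⟨X', q, hq₀, rfl⟩
    rw [hy.eq hm hu hn, Ln.smul_pi]

end Action

/-! ### The modular curve `Γ₀(n)\ℍ` -/

namespace Ln

variable {n : ℕ}

/-- The homomorphism `ℂ/L → ℂ/M` induced by multiplication by `b`, if `bL ⊆ M`. -/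
def mulHom (b : ℂ) (p p' : Ln n) (h : ∀ z ∈ p.L, b * z ∈ p'.L) :
    p.toTriple.E →+ p'.toTriple.E :=
  QuotientAddGroup.lift p.L (p'.proj.comp (AddMonoidHom.mulLeft b)) fun z hz =>
    p'.ker_proj.ge (h z hz)

theorem isHol_mulHom (b : ℂ) (p p' : Ln n) (h : ∀ z ∈ p.L, b * z ∈ p'.L) :
    Triple.IsHol p.toTriple p'.toTriple (mulHom b p p' h) := by
  have hmul : ContMDiff 𝓘(ℂ, ℂ) 𝓘(ℂ, ℂ) ω (fun z : ℂ => b * z) :=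
    contMDiff_iff_contDiff.2 (by fun_prop)
  exact Torus.contMDiff_of_comp_mk (L := p.L) (p'.contMDiff_proj.comp hmul)

end Ln

theorem LQ.tau_surjective : Function.Surjective LQ.tau := fun τ =>
  ⟨LQ.ofPair τ 1 (by simpa using τ.im_pos), by
    apply UpperHalfPlane.ext
    change (LQ.ofPair (τ : ℂ) 1 _).1 ![1, 0] / (LQ.ofPair (τ : ℂ) 1 _).1 ![0, 1] = τ
    rw [LQ.ofPair_fst, LQ.ofPair_snd, div_one]⟩

theorem Y0.exists_mk_tau {n : ℕ} (y : Y0 n) : ∃ ψ : LQ, Y0.mk n ψ.tau = y := by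
  obtain ⟨τ, rfl⟩ := Quotient.exists_rep y
  obtain ⟨ψ, rfl⟩ := LQ.tau_surjective τ
  exact ⟨ψ, rfl⟩

variable {n : ℕ} [NeZero n]

/-- Homothetic lattice pairs give isomorphic pairs `(E, C)`. -/
theorem forget_F_homothety (b : ℂ) (hb : b ≠ 0) (ψ : LQ) :
    (F n (Ln.pi n (LQ.homothety b hb ψ))).forget = (F n (Ln.pi n ψ)).forget := by
  let p := Ln.pi n ψ
  let p' := Ln.pi n (LQ.homothety b hb ψ)
  have h : ∀ z ∈ p.L, b * z ∈ p'.L := fun z hz =>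
    LQ.mem_lattice_homothety.2 (by rwa [inv_mul_cancel_left₀ hb])
  have h' : ∀ z ∈ p'.L, b⁻¹ * z ∈ p.L := fun z hz => LQ.mem_lattice_homothety.1 hz
  let f : p.toTriple.E ≃+ p'.toTriple.E :=
    (Ln.mulHom b p p' h).toAddEquiv (Ln.mulHom b⁻¹ p' p h')
      (by
        ext P
        obtain ⟨z, rfl⟩ := p.proj_surjective P
        exact congrArg p.proj (inv_mul_cancel_left₀ hb z))
      (by
        ext P
        obtain ⟨z, rfl⟩ := p'.proj_surjective P
        exact congrArg p'.proj (mul_inv_cancel_left₀ hb z))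
  refine (Quotient.sound (s := ⟨Triple.PairIso, Triple.pairIso_equivalence⟩)
    ⟨f, Ln.isHol_mulHom b p p' h, Ln.isHol_mulHom b⁻¹ p' p h', ?_⟩).symm
  rw [(Triple.IsUniformization.proj ψ).C_eq, (Triple.IsUniformization.proj _).C_eq,
    AddMonoidHom.map_zmultiples, LQ.homothety_hom, mul_left_comm]
  rfl

/-- Every triple in the class of a pair `(ℂ/L_ψ, L_{γ_n ψ}/L_ψ)` comes from a multiple of `ψ`. -/
theorem exists_eq_F_homothety {x : Can n} {ψ : LQ} (h : x.forget = (F n (Ln.pi n ψ)).forget) :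
    ∃ (b : ℂ) (hb : b ≠ 0), x = F n (Ln.pi n (LQ.homothety b hb ψ)) := by
  obtain ⟨X, rfl⟩ : ∃ X : Triple n, X.toCan = x := Quotient.exists_rep x
  obtain ⟨u, hu⟩ := Triple.exists_isUniformization h
  obtain ⟨b, hb, u', hu', hn', -⟩ := hu.exists_isNormalized
  exact ⟨b, hb, hu'.toCan_eq hn'⟩

/-- The classes of pairs `(E, C)` belonging to `ψ` and `ψ'` agree if and only if `ψ'` is in the
`Γ₀(n)`-orbit of a multiple of `ψ`, that is, if the points of `ℍ` are equivalent under `Γ₀(n)`. -/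
theorem forget_F_eq_iff {ψ ψ' : LQ} :
    (F n (Ln.pi n ψ)).forget = (F n (Ln.pi n ψ')).forget ↔
      Y0.mk n ψ.tau = Y0.mk n ψ'.tau := by
  rw [Y0.mk_eq_iff]
  constructor
  · intro h
    obtain ⟨b, hb, hF⟩ := exists_eq_F_homothety h
    obtain ⟨g, hg, e⟩ := Ln.exists_of_pi_eq (F_injective n hF).symm
    refine ⟨g, hg, ?_⟩
    rw [← e, LQ.tau_smul, LQ.tau_homothety]
  · rintro ⟨g, hg, e⟩
    rw [← LQ.tau_smul] at e
    obtain ⟨b, hb, rfl⟩ := LQ.exists_homothety_of_tau_eq e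
    rw [forget_F_homothety, Ln.pi_smul_of_mem hg]

/-- The embedding of `Γ₀(n)\ℍ` into the set of isomorphism classes of pairs `(E, C)`. -/
def Y0.toPairCan (y : Y0 n) : PairCan n := (F n (Ln.pi n (Y0.exists_mk_tau y).choose)).forget

theorem Y0.toPairCan_mk (ψ : LQ) :
    Y0.toPairCan (Y0.mk n ψ.tau) = (F n (Ln.pi n ψ)).forget :=
  forget_F_eq_iff.2 (Y0.exists_mk_tau (Y0.mk n ψ.tau)).choose_spec

theorem Y0.toPairCan_injective : Function.Injective (Y0.toPairCan (n := n)) := fun y y' h => by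
  obtain ⟨ψ, rfl⟩ := Y0.exists_mk_tau y
  obtain ⟨ψ', rfl⟩ := Y0.exists_mk_tau y'
  rw [Y0.toPairCan_mk, Y0.toPairCan_mk] at h
  exact forget_F_eq_iff.1 h

theorem pairAction_toPairCan (γ : BGamma0 n) (y : Y0 n) :
    pairAction γ.1 y.toPairCan = {(γ • y).toPairCan} := by
  obtain ⟨ψ, rfl⟩ := Y0.exists_mk_tau y
  rw [Y0.smul_mk, ← LQ.tau_smul, Y0.toPairCan_mk, Y0.toPairCan_mk]
  refine Set.eq_singleton_iff_unique_mem.2 ⟨?_, ?_⟩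
  · refine ⟨F n (Ln.pi n ψ), F n (γ • Ln.pi n ψ), rfl, ?_, ?_⟩
    · rw [Ln.smul_pi]
    · rw [moduliAction_F]
      rfl
  · rintro _ ⟨x', y', hx, rfl, hy⟩
    obtain ⟨b, hb, rfl⟩ := exists_eq_F_homothety hx
    rw [eq_of_mem_moduliAction hy, Ln.smul_pi, LQ.smul_homothety, forget_F_homothety]

end

theorem mainTheorem8 (n : ℕ) [NeZero n] :
    (∀ (γ : BGamma0 n) (p : Ln n), moduliAction γ.1 (F n p) = {F n (γ • p)}) ∧
    (∀ (γ : BGamma0 n) (p : Ln n), PreservesLevel n γ.1 →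
      unorientedAction γ.1 (F n p) = {F n (γ • p)}) ∧
    ∃ j : Y0 n → PairCan n, Function.Injective j ∧
      (∀ ψ : LQ, j (Y0.mk n ψ.tau) = (F n (Ln.pi n ψ)).forget) ∧
      ∀ (γ : BGamma0 n) (y : Y0 n), pairAction γ.1 (j y) = {j (γ • y)} :=
  ⟨moduliAction_F, unorientedAction_F,
    Y0.toPairCan, Y0.toPairCan_injective, Y0.toPairCan_mk, pairAction_toPairCan⟩
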